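/- Let $m\ge 2$ agents be the nodes of a connected graph, $\mathcal N_i$ being the set of neighbors of agent $i$. Let $f\colon\mathbf R^p\to\mathbf R\cup\{+\infty\}$ be a closed proper convex function, $\epsilon\in\mathbf R$, and let agent $i$ hold $X_i\in\mathbf R^{n\times p}$ and $y_i\in\mathbf R^n$, with $X=X_1+\cdots+X_m$ and $y=y_1+\cdots+y_m$. Consider the problems $$P_0\colon\ \min_{\beta\in\mathbf R^p} f(\beta)\ \text{ s.t. }\ \|X\beta-y\|_2\le\epsilon,\qquad P_1\colon\ \min_{\beta\in\mathbf R^p} f(\beta)\ \text{ s.t. }\ \Big\|\sum_{i=1}^m X_i\beta-\sum_{i=1}^m y_i\Big\|_2\le\epsilon .$$ Assume that $P_1$ has a solution (a feasible minimizer at which $f$ is finite), and that the following constraint qualification holds: some $\beta$ in the relative interior of $\operatorname{dom} f=\{f<+\infty\}$ satisfies $\|X\beta-y\|_2<\epsilon$, or $X\beta=y$ in case $\epsilon=0$. Let $\lambda>0$ and $0<\rho<2$. Write $\operatorname{prox}_g(\zeta)$ for the minimizer of $g(z)+\frac12\|z-\zeta\|_2^2$ and $F_\lambda(v)=2\operatorname{prox}_{(\lambda/2)f}(v/2)$.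 The in-network Douglas–Rachford scheme starts from arbitrary $a_{ij,0}\in\mathbf R^n$, $b_{ij,0}\in\mathbf R^p$ ($j\in\mathcal N_i$). For $k=0,1,2,\dots$, each agent $i$ takes for $\big((\hat a_{ij,k+1})_{j\in\mathcal N_i},\hat\beta_{i,k+1}\big)$ the vectors $\big((a_{ij})_{j\in\mathcal N_i},\beta\big)$ that minimize $$\sum_{j\in\mathcal N_i}\Big\{\|a_{ij}+a_{ji,k}\|_2^2+\|\beta+b_{ij,k}-F_\lambda(b_{ij,k}+b_{ji,k})\|_2^2\Big\}\quad\text{s.t.}\quad \Big\|X_i\beta-y_i+\sum_{j\in\mathcal N_i}a_{ij}\Big\|_2\le\frac{\epsilon}{m},$$ and then sets, for $j\in\mathcal N_i$, $$a_{ij,k+1}=a_{ij,k}-\tfrac{\rho}{2}(a_{ij,k}-a_{ji,k})+\rho\,\hat a_{ij,k+1},\qquad b_{ij,k+1}=b_{ij,k}-\tfrac{\rho}{2}F_\lambda(b_{ij,k}+b_{ji,k})+\rho\,\hat\beta_{i,k+1}.$$ Then from every initialization the scheme can be run (the local problems have minimizers), and for every run there is a solution $\beta^\star$ of $P_1$,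 which is also a solution of $P_0$, such that at each agent $i$ the sequence $\hat\beta_{i,1},\hat\beta_{i,2},\dots$ converges to $\beta^\star$. -/

import Mathlib

open Filter Topology

noncomputable section

namespace InNetworkDR

/-- `f : E → ℝ ∪ {+∞}` is closed (lower semicontinuous), proper and convex. -/
structure IsClosedProperConvex {E : Type*} [NormedAddCommGroup E] [NormedSpace ℝ E]
    (f : E → EReal) : Prop where
  /-- the value `-∞` is not taken -/
  ne_bot : ∀ x, f x ≠ ⊥
  /-- the effective domain is nonempty -/
  exists_ne_top : ∃ x, f x ≠ ⊤
  closed : LowerSemicontinuous f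
  /-- the epigraph is convex -/
  convex : Convex ℝ {q : E × ℝ | f q.1 ≤ (q.2 : EReal)}

/-- The effective domain of `f`. -/
def effDom {E : Type*} (f : E → EReal) : Set E := {x | f x ≠ ⊤}

/-- `z` minimizes `g(z) + (1/2)‖z - ζ‖²`. -/
def IsProx {E : Type*} [NormedAddCommGroup E] (g : E → EReal) (ζ z : E) : Prop :=
  ∀ w : E, g z + ((1 / 2 * ‖z - ζ‖ ^ 2 : ℝ) : EReal) ≤ g w + ((1 / 2 * ‖w - ζ‖ ^ 2 : ℝ) : EReal)

/-- The proximal operator of `g`, for `g` closed, proper and convex: the value at `ζ` is the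
minimizer of `g(z) + (1/2)‖z - ζ‖²`, which in that case exists and is unique. -/
def prox {E : Type*} [NormedAddCommGroup E] (g : E → EReal) (ζ : E) : E :=
  Classical.epsilon (IsProx g ζ)

/-- `F_λ(v) = 2 prox_{(λ/2) f}((1/2) v)`. -/
def F {E : Type*} [NormedAddCommGroup E] [NormedSpace ℝ E]
    (lam : ℝ) (f : E → EReal) (v : E) : E :=
  (2 : ℝ) • prox (fun x => ((lam / 2 : ℝ) : EReal) * f x) ((1 / 2 : ℝ) • v)

section Problems

variable {m n p : ℕ}

/-- The residual `‖X β - y‖₂`. -/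
def residual (X : Matrix (Fin n) (Fin p) ℝ) (y : EuclideanSpace ℝ (Fin n))
    (β : EuclideanSpace ℝ (Fin p)) : ℝ :=
  ‖Matrix.toEuclideanLin X β - y‖

/-- `β` solves `P₀`: minimize `f(β)` subject to `‖X β - y‖₂ ≤ ε`. -/
structure SolvesP0 (f : EuclideanSpace ℝ (Fin p) → EReal) (ε : ℝ)
    (X : Matrix (Fin n) (Fin p) ℝ) (y : EuclideanSpace ℝ (Fin n))
    (β : EuclideanSpace ℝ (Fin p)) : Prop where
  feasible : residual X y β ≤ ε
  finite : f β ≠ ⊤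
  minimal : ∀ β' : EuclideanSpace ℝ (Fin p), residual X y β' ≤ ε → f β ≤ f β'

/-- `β` solves `P₁`: minimize `f(β)` subject to
`‖(X₁ + ⋯ + X_m) β - (y₁ + ⋯ + y_m)‖₂ ≤ ε`. -/
def SolvesP1 (f : EuclideanSpace ℝ (Fin p) → EReal) (ε : ℝ)
    (Xs : Fin m → Matrix (Fin n) (Fin p) ℝ) (ys : Fin m → EuclideanSpace ℝ (Fin n))
    (β : EuclideanSpace ℝ (Fin p)) : Prop :=
  SolvesP0 f ε (∑ i, Xs i) (∑ i, ys i) β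

end Problems

section Scheme

variable {m n p : ℕ}

/-- The iterates of the scheme. `a k i j`, `b k i j` are `a_{ij,k}`, `b_{ij,k}`; `aHat k i j` and
`betaHat k i` are `â_{ij,k}` and `β̂_{i,k}`, which the scheme produces for `k ≥ 1`. Only the entries
with `i` and `j` neighbors matter. -/
structure Iterates (m n p : ℕ) where
  a : ℕ → Fin m → Fin m → EuclideanSpace ℝ (Fin n)
  b : ℕ → Fin m → Fin m → EuclideanSpace ℝ (Fin p)
  aHat : ℕ → Fin m → Fin m → EuclideanSpace ℝ (Fin n)
  betaHat : ℕ → Fin m → EuclideanSpace ℝ (Fin p)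

/-- The constraint of the local problem of an agent with neighbors `N` and data `(X, y)`:
`‖X β - y + α‖₂ ≤ ε / m`, where `α = ∑_{j ∈ N} a_j`. -/
def LocalFeasible (ε : ℝ) (m : ℕ) (X : Matrix (Fin n) (Fin p) ℝ)
    (y : EuclideanSpace ℝ (Fin n)) (N : Finset (Fin m))
    (a : Fin m → EuclideanSpace ℝ (Fin n)) (β : EuclideanSpace ℝ (Fin p)) : Prop :=
  ‖Matrix.toEuclideanLin X β - y + ∑ j ∈ N, a j‖ ≤ ε / (m : ℝ)

/-- The cost of the local problem of an agent with neighbors `N`: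
`∑_{j ∈ N} (‖a_j + aIn_j‖² + ‖β + bOwn_j - F_λ(bOwn_j + bIn_j)‖²)`, where `bOwn_j` is the agent's
own vector `b_{ij,k}`, and `aIn_j = a_{ji,k}`, `bIn_j = b_{ji,k}` are received from neighbor `j`. -/
def localCost (lam : ℝ) (f : EuclideanSpace ℝ (Fin p) → EReal) (N : Finset (Fin m))
    (aIn : Fin m → EuclideanSpace ℝ (Fin n)) (bOwn bIn : Fin m → EuclideanSpace ℝ (Fin p))
    (a : Fin m → EuclideanSpace ℝ (Fin n)) (β : EuclideanSpace ℝ (Fin p)) : ℝ :=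
  ∑ j ∈ N, (‖a j + aIn j‖ ^ 2 + ‖β + bOwn j - F lam f (bOwn j + bIn j)‖ ^ 2)

/-- `R` is a run of the in-network Douglas–Rachford scheme for linear regression on the network
`G`, with parameters `λ` and `ρ` (from the initial vectors `R.a 0`, `R.b 0`). -/
structure IsRun (G : SimpleGraph (Fin m)) [DecidableRel G.Adj]
    (f : EuclideanSpace ℝ (Fin p) → EReal) (ε : ℝ)
    (Xs : Fin m → Matrix (Fin n) (Fin p) ℝ) (ys : Fin m → EuclideanSpace ℝ (Fin n))
    (lam ρ : ℝ) (R : Iterates m n p) : Prop where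
  /-- the local minimization: feasibility -/
  feasible : ∀ k i,
    LocalFeasible ε m (Xs i) (ys i) (G.neighborFinset i) (R.aHat (k + 1) i) (R.betaHat (k + 1) i)
  /-- the local minimization: optimality -/
  minimal : ∀ k i (a : Fin m → EuclideanSpace ℝ (Fin n)) (β : EuclideanSpace ℝ (Fin p)),
    LocalFeasible ε m (Xs i) (ys i) (G.neighborFinset i) a β →
      localCost lam f (G.neighborFinset i) (fun j => R.a k j i) (R.b k i) (fun j => R.b k j i)
          (R.aHat (k + 1) i) (R.betaHat (k + 1) i)
        ≤ localCost lam f (G.neighborFinset i) (fun j => R.a k j i) (R.b k i)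
            (fun j => R.b k j i) a β
  update_a : ∀ k i j, G.Adj i j →
    R.a (k + 1) i j
      = R.a k i j - (ρ / 2) • (R.a k i j - R.a k j i) + ρ • R.aHat (k + 1) i j
  update_b : ∀ k i j, G.Adj i j →
    R.b (k + 1) i j
      = R.b k i j - (ρ / 2) • F lam f (R.b k i j + R.b k j i) + ρ • R.betaHat (k + 1) i

end Scheme

end InNetworkDR

end

/-! The scheme is a relaxed Douglas–Rachford iteration in disguise. It lives in a Euclidean space
`ArcSpace` with one pair `(a_ij, b_ij)` for each arc of the graph. There `P₁` becomes the
minimization of `(λ/2) ∑ f(b_ij)` over the arcs under two families of constraints.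

Edge constraints: `a_ij = -a_ji` and `b_ij = b_ji`. The proximal map of the cost together with these
is `edgeMap`. Agent constraints: `b_ij = β_i` for all `j`, and the local residual plus `∑_j a_ij`
has norm at most `ε/m`. Their proximal map is the projection onto `agentSet`. The reflected point `2
edgeMap z - z` has entries `-a_ji` and `F_λ(b_ij + b_ji) - b_ij`, so its squared distance to a point
of `agentSet` is the sum of the local costs, and projecting it means solving all local problems
(`sum_localCost`, `IsRun.douglasRachford`).

The two formulations agree because the graph is connected: the `b_ij` all coincide and antisymmetric
`a_ij` cancel in the sum over agents; conversely, every zero-sum divergence comes from an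
antisymmetric flow (`exists_antisymm_flow`), so a global residual can be split equally.

In finite dimension the iteration converges once a fixed point exists (`douglasRachford_tendsto`).
The constraint qualification supplies one: it gives a Lagrange multiplier
(`exists_lagrange_multiplier`), which a second flow spreads over the arcs
(`exists_douglasRachford_fixedPoint`). Conversely, every fixed point encodes a solution
(`solution_of_douglasRachford_fixedPoint`). -/

noncomputable section

namespace InNetworkDR

/-! ### Relaxed Douglas–Rachford iteration for two firmly nonexpansive maps -/

section DouglasRachford

variable {H : Type*} [NormedAddCommGroup H] [InnerProductSpace ℝ H]

/-- `J` is firmly nonexpansive. -/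
def FirmlyNonexpansive (J : H → H) : Prop :=
  ∀ x y, ‖J x - J y‖ ^ 2 ≤ inner ℝ (J x - J y) (x - y)

theorem FirmlyNonexpansive.lipschitzWith {J : H → H} (hJ : FirmlyNonexpansive J) :
    LipschitzWith 1 J := by
  refine LipschitzWith.of_dist_le_mul fun x y => ?_
  rw [dist_eq_norm, dist_eq_norm, NNReal.coe_one, one_mul]
  have h1 := hJ x y
  have h2 := real_inner_le_norm (J x - J y) (x - y)
  by_contra! h
  have : 0 < ‖J x - J y‖ := (norm_nonneg _).trans_lt h
  nlinarith

theorem FirmlyNonexpansive.continuous {J : H → H} (hJ : FirmlyNonexpansive J) : Continuous J :=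
  hJ.lipschitzWith.continuous

variable {J₁ J₂ : H → H}

/-- A relaxed Douglas–Rachford step decreases the distance to each fixed point. -/
theorem norm_douglasRachford_step_le (h₁ : FirmlyNonexpansive J₁) (h₂ : FirmlyNonexpansive J₂)
    {ρ : ℝ} (hρ : 0 < ρ) {w : H} (hw : J₁ ((2 : ℝ) • J₂ w - w) = J₂ w) (z : H) :
    ‖z + ρ • (J₁ ((2 : ℝ) • J₂ z - z) - J₂ z) - w‖ ^ 2
      + ρ * (2 - ρ) * ‖J₁ ((2 : ℝ) • J₂ z - z) - J₂ z‖ ^ 2 ≤ ‖z - w‖ ^ 2 := by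
  have a := h₂ z w
  have b := h₁ ((2 : ℝ) • J₂ z - z) ((2 : ℝ) • J₂ w - w)
  rw [hw] at b
  generalize J₁ ((2 : ℝ) • J₂ z - z) = q at *
  generalize J₂ z = p at *
  generalize J₂ w = x at *
  -- After translating the fixed point data to the origin, the claim is `2ρ` times the sum of `‖P‖²
  -- ≤ ⟪P, Z⟫` and `‖Q‖² ≤ ⟪Q, 2P - Z⟫`.
  obtain ⟨P, rfl⟩ : ∃ P, p = P + x := ⟨p - x, by simp⟩
  obtain ⟨Q, rfl⟩ : ∃ Q, q = Q + x := ⟨q - x, by simp⟩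
  obtain ⟨Z, rfl⟩ : ∃ Z, z = Z + w := ⟨z - w, by simp⟩
  have e1 : (2 : ℝ) • (P + x) - (Z + w) - ((2 : ℝ) • x - w) = (2 : ℝ) • P - Z := by module
  have e2 : Z + w + ρ • (Q + x - (P + x)) - w = Z + ρ • (Q - P) := by module
  have e3 : Q + x - (P + x) = Q - P := by module
  rw [e1] at b
  rw [e2, e3]
  simp only [add_sub_cancel_right] at a b ⊢
  rw [norm_add_sq_real, norm_smul, real_inner_smul_right, mul_pow, Real.norm_eq_abs, sq_abs,
    norm_sub_sq_real, inner_sub_right, real_inner_comm Q Z, real_inner_comm P Z,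
    real_inner_comm P Q]
  rw [inner_sub_right, real_inner_smul_right] at b
  have c1 : inner ℝ Q P = inner ℝ P Q := real_inner_comm _ _
  nlinarith

/-- Convergence of the relaxed Douglas–Rachford iteration in finite dimension. -/
theorem douglasRachford_tendsto [FiniteDimensional ℝ H]
    (h₁ : FirmlyNonexpansive J₁) (h₂ : FirmlyNonexpansive J₂)
    {ρ : ℝ} (hρ : 0 < ρ) (hρ2 : ρ < 2) (hfix : ∃ w, J₁ ((2 : ℝ) • J₂ w - w) = J₂ w)
    (z : ℕ → H) (hz : ∀ k, z (k + 1) = z k + ρ • (J₁ ((2 : ℝ) • J₂ (z k) - z k) - J₂ (z k))) :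
    ∃ w, J₁ ((2 : ℝ) • J₂ w - w) = J₂ w ∧
      Tendsto (fun k => J₁ ((2 : ℝ) • J₂ (z k) - z k)) atTop (𝓝 (J₂ w)) := by
  have c₁ := h₁.continuous
  have c₂ := h₂.continuous
  set T : H → H := fun v => J₁ ((2 : ℝ) • J₂ v - v) with hT
  have cT : Continuous T := by fun_prop
  have hc : 0 < ρ * (2 - ρ) := mul_pos hρ (by linarith)
  have step : ∀ w, T w = J₂ w → ∀ k,
      ‖z (k + 1) - w‖ ^ 2 + ρ * (2 - ρ) * ‖T (z k) - J₂ (z k)‖ ^ 2 ≤ ‖z k - w‖ ^ 2 := by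
    intro w hw k
    rw [hz]
    exact norm_douglasRachford_step_le h₁ h₂ hρ hw (z k)
  have anti : ∀ w, T w = J₂ w → Antitone fun k => ‖z k - w‖ ^ 2 := by
    refine fun w hw => antitone_nat_of_succ_le fun k => ?_
    have := step w hw k
    have : 0 ≤ ρ * (2 - ρ) * ‖T (z k) - J₂ (z k)‖ ^ 2 := by positivity
    linarith
  have conv : ∀ w, T w = J₂ w → ∃ l, Tendsto (fun k => ‖z k - w‖ ^ 2) atTop (𝓝 l) := fun w hw =>
    ⟨_, tendsto_atTop_ciInf (anti w hw) ⟨0, by rintro _ ⟨k, rfl⟩; positivity⟩⟩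
  obtain ⟨w₀, hw₀⟩ := hfix
  -- The squared distances to `w₀` converge, so their successive differences, which dominate the
  -- residuals, tend to zero.
  have hres : Tendsto (fun k => ‖T (z k) - J₂ (z k)‖ ^ 2) atTop (𝓝 0) := by
    obtain ⟨l, hl⟩ := conv w₀ hw₀
    have h := (hl.sub (hl.comp (tendsto_add_atTop_nat 1))).const_mul (ρ * (2 - ρ))⁻¹
    rw [sub_self, mul_zero] at h
    refine squeeze_zero (fun k => by positivity) (fun k => ?_) h
    rw [← div_eq_inv_mul, le_div_iff₀ hc]
    have := step w₀ hw₀ k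
    simp only [Function.comp]
    linarith
  have : ProperSpace H := FiniteDimensional.proper ℝ H
  obtain ⟨w, -, φ, hφ, hw⟩ := tendsto_subseq_of_bounded
    (Metric.isBounded_closedBall (x := w₀) (r := ‖z 0 - w₀‖)) (x := z) (fun k => by
      rw [Metric.mem_closedBall, dist_eq_norm]
      exact le_of_sq_le_sq (anti w₀ hw₀ (Nat.zero_le k)) (norm_nonneg _))
  have hwfix : T w = J₂ w := by
    have h1 : Tendsto (fun k => ‖T (z (φ k)) - J₂ (z (φ k))‖ ^ 2) atTop
        (𝓝 (‖T w - J₂ w‖ ^ 2)) :=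
      ((by fun_prop : Continuous fun v => ‖T v - J₂ v‖ ^ 2).tendsto w).comp hw
    have h2 := tendsto_nhds_unique h1 (hres.comp hφ.tendsto_atTop)
    simpa [sub_eq_zero] using h2
  -- Opial's argument: the cluster point `w` is itself a fixed point, so the distance to it
  -- converges along the whole sequence, and a subsequence forces the limit to be zero.
  have hlim : Tendsto z atTop (𝓝 w) := by
    obtain ⟨l, hl⟩ := conv w hwfix
    have h1 : Tendsto (fun k => ‖z (φ k) - w‖ ^ 2) atTop (𝓝 (‖w - w‖ ^ 2)) :=
      ((by fun_prop : Continuous fun v => ‖v - w‖ ^ 2).tendsto w).comp hw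
    have h2 := tendsto_nhds_unique (hl.comp hφ.tendsto_atTop) h1
    rw [h2, sub_self, norm_zero] at hl
    rw [tendsto_iff_norm_sub_tendsto_zero]
    have h3 := hl.sqrt
    simpa [Real.sqrt_sq] using h3
  refine ⟨w, hwfix, ?_⟩
  rw [← hwfix]
  exact (cT.tendsto w).comp hlim

end DouglasRachford

/-! ### Convex separation and Lagrange multipliers -/

/-- Proper separation of the origin from a convex set. -/
theorem exists_properly_separating {E : Type*} [NormedAddCommGroup E] [NormedSpace ℝ E]
    [FiniteDimensional ℝ E] {C : Set E} (hC : Convex ℝ C) (hne : C.Nonempty) (h0 : (0 : E) ∉ C) :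
    ∃ l : StrongDual ℝ E, (∀ c ∈ C, 0 ≤ l c) ∧ ∃ c ∈ C, 0 < l c := by
  set S := Submodule.span ℝ C with hS
  set C' : Set S := (fun x : S => (x : E)) ⁻¹' C with hC'
  have cC' : Convex ℝ C' := hC.linear_preimage S.subtype
  -- Inside its own span, the cone over `C` has nonempty interior, so a nonzero functional separates
  -- it from `0`. If that functional vanished on `C`, it would vanish on the span.
  set K := ConvexCone.hull ℝ C' with hK
  have memK : ∀ c ∈ C', c ∈ (K : Set S) := fun c hc => ConvexCone.subset_hull hc
  have zero_notMem : (0 : S) ∉ (K : Set S) := by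
    intro h
    obtain ⟨t, ht, c, hc, h⟩ := (ConvexCone.mem_hull_of_convex cC').1 h
    simp only at h
    rcases smul_eq_zero.1 h with h | h
    · exact ht.ne' h
    · rw [h] at hc
      exact h0 hc
  have spanC' : Submodule.span ℝ C' = ⊤ := Submodule.span_span_coe_preimage
  obtain ⟨c₀, hc₀⟩ := hne
  have hc₀' : (⟨c₀, Submodule.subset_span hc₀⟩ : S) ∈ C' := hc₀
  generalize (⟨c₀, Submodule.subset_span hc₀⟩ : S) = s₀ at hc₀'
  have zero_mem : (0 : S) ∈ affineSpan ℝ (K : Set S) := by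
    have h1 := subset_affineSpan ℝ (K : Set S) (memK _ hc₀')
    have h2 := subset_affineSpan ℝ (K : Set S) (K.smul_mem (two_pos (α := ℝ)) (memK _ hc₀'))
    -- The origin lies on the line through `s₀` and `2 s₀`.
    have h3 := AffineMap.lineMap_mem (-1 : ℝ) h1 h2
    convert h3 using 1
    rw [AffineMap.lineMap_apply_module]
    module
  have top : affineSpan ℝ (K : Set S) = ⊤ := by
    rw [← AffineSubspace.direction_eq_top_iff_of_nonempty ⟨0, zero_mem⟩, eq_top_iff, ← spanC',
      Submodule.span_le]
    intro c hc
    have := AffineSubspace.vsub_mem_direction (subset_affineSpan ℝ (K : Set S) (memK _ hc)) zero_mem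
    simpa using this
  have hint := (K.convex.interior_nonempty_iff_affineSpan_eq_top).2 top
  obtain ⟨l, hl, hle⟩ := geometric_hahn_banach_of_nonempty_interior_point K.convex
    (fun h => zero_notMem (interior_subset h)) hint
  obtain ⟨g, hg, -⟩ := exists_extension_norm_eq S l
  have hgl : ∀ c (hc : c ∈ C), g c = l ⟨c, Submodule.subset_span hc⟩ := fun c hc =>
    hg ⟨c, Submodule.subset_span hc⟩
  have hneg : ∀ c ∈ C, g c ≤ 0 := by
    intro c hc
    rw [hgl c hc]
    have := hle ⟨c, Submodule.subset_span hc⟩ (memK _ hc)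
    rwa [map_zero] at this
  refine ⟨-g, fun c hc => by simpa using hneg c hc, ?_⟩
  by_contra! hcon
  apply hl
  have hz : ∀ c ∈ C', l c = 0 := by
    intro c hc
    have h1 := hcon c hc
    have h2 := hneg c hc
    rw [← hg c]
    simp only [neg_apply, Left.neg_nonpos_iff] at h1
    exact le_antisymm h2 h1
  ext x
  have hx : x ∈ Submodule.span ℝ C' := spanC' ▸ Submodule.mem_top
  induction hx using Submodule.span_induction with
  | mem x h => simpa using hz x h
  | zero => simp
  | add x y _ _ hx hy => rw [map_add, hx, hy]; simp
  | smul a x _ hx => rw [map_smul, hx]; simp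

/-- From a relative interior point, one can move a little away from any point of the set. -/
theorem exists_pos_sub_smul_mem_of_mem_intrinsicInterior {E : Type*} [NormedAddCommGroup E]
    [NormedSpace ℝ E] {D : Set E} {x₀ x : E} (h₀ : x₀ ∈ intrinsicInterior ℝ D) (hx : x ∈ D) :
    ∃ δ : ℝ, 0 < δ ∧ x₀ - δ • (x - x₀) ∈ D := by
  obtain ⟨s₀, hs₀, rfl⟩ := mem_intrinsicInterior.1 h₀
  have hmem : ∀ t : ℝ, (s₀ : E) - t • (x - s₀) ∈ affineSpan ℝ D := by
    intro t
    have := AffineMap.lineMap_mem (-t) s₀.2 (subset_affineSpan ℝ D hx)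
    convert this using 1
    rw [AffineMap.lineMap_apply_module]
    module
  set g : ℝ → affineSpan ℝ D := fun t => ⟨(s₀ : E) - t • (x - s₀), hmem t⟩ with hg
  have cg : Continuous g := by
    refine Continuous.subtype_mk ?_ _
    fun_prop
  have g0 : g 0 = s₀ := by simp [hg]
  have hn : ∀ᶠ t in 𝓝 (0 : ℝ), g t ∈ ((↑) ⁻¹' D : Set (affineSpan ℝ D)) := by
    refine cg.continuousAt.eventually_mem ?_
    rw [g0]
    exact mem_interior_iff_mem_nhds.1 hs₀
  obtain ⟨δ, hδ, h⟩ := ((hn.filter_mono nhdsWithin_le_nhds).and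
    (self_mem_nhdsWithin (a := (0 : ℝ)) (s := Set.Ioi 0))).exists
  exact ⟨δ, h, hδ⟩

/-- A Lagrange multiplier for the minimization of a convex function subject to `‖L x - y‖ ≤ ε`. -/
theorem exists_lagrange_multiplier {E U : Type*} [NormedAddCommGroup E] [NormedSpace ℝ E]
    [NormedAddCommGroup U] [InnerProductSpace ℝ U] [FiniteDimensional ℝ U]
    (L : E →ₗ[ℝ] U) (y : U) {ε : ℝ} {D : Set E} {φ : E → ℝ} (hφ : ConvexOn ℝ D φ)
    {xs : E} (hxs : xs ∈ D) (hfeas : ‖L xs - y‖ ≤ ε)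
    (hmin : ∀ x ∈ D, ‖L x - y‖ ≤ ε → φ xs ≤ φ x)
    (hqual : ∃ x₀ ∈ intrinsicInterior ℝ D, ‖L x₀ - y‖ < ε ∨ (ε = 0 ∧ ‖L x₀ - y‖ = 0)) :
    ∃ ν : U, ∀ x ∈ D, ∀ q : U, ‖q‖ ≤ ε → φ xs ≤ φ x + inner ℝ ν (L x - y - q) := by
  -- Perturbed constraint levels and values strictly above the value gap; optimality of `xs` says
  -- that `0 ∉ C`.
  set C : Set (U × ℝ) := {c | ∃ x ∈ D, ‖L x - y - c.1‖ ≤ ε ∧ φ x - φ xs < c.2} with hCdef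
  have hC : Convex ℝ C := by
    rintro ⟨w, t⟩ ⟨x, hx, hw, ht⟩ ⟨w', t'⟩ ⟨x', hx', hw', ht'⟩ a b ha hb hab
    refine ⟨a • x + b • x', hφ.1 hx hx' ha hb hab, ?_, ?_⟩
    · have e : L (a • x + b • x') - y - (a • (w, t) + b • (w', t')).1
          = a • (L x - y - w) + b • (L x' - y - w') := by
        have : y = (a + b) • y := by rw [hab, one_smul]
        simp only [map_add, map_smul, Prod.fst_add, Prod.smul_fst]
        nth_rewrite 1 [this]
        module
      rw [e]
      refine (norm_add_le _ _).trans ?_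
      rw [norm_smul, norm_smul, Real.norm_of_nonneg ha, Real.norm_of_nonneg hb]
      calc a * ‖L x - y - w‖ + b * ‖L x' - y - w'‖ ≤ a * ε + b * ε := by gcongr
        _ = ε := by rw [← add_mul, hab, one_mul]
    · have h := hφ.2 hx hx' ha hb hab
      simp only [smul_eq_mul, Prod.snd_add, Prod.smul_snd] at h ⊢
      have e : φ xs = (a + b) * φ xs := by rw [hab, one_mul]
      simp only at ht ht'
      -- The strict inequality survives only through a positive weight, hence the separate case `a =
      -- 0`.
      rcases ha.eq_or_lt with rfl | ha'
      · have : b = 1 := by linarith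
        subst this
        simp only [zero_mul, one_mul, zero_add] at h ⊢
        linarith
      · nlinarith [mul_lt_mul_of_pos_left ht ha', mul_le_mul_of_nonneg_left ht'.le hb]
  have h0 : (0 : U × ℝ) ∉ C := by
    rintro ⟨x, hx, hw, ht⟩
    simp only [Prod.fst_zero, sub_zero, Prod.snd_zero] at hw ht
    linarith [hmin x hx hw]
  have hε : 0 ≤ ε := (norm_nonneg _).trans hfeas
  have hne : C.Nonempty := ⟨(L xs - y, 1), xs, hxs, by simpa using hε, by simp⟩
  obtain ⟨l, hl, c₁, hc₁, hlc₁⟩ := exists_properly_separating hC hne h0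
  set ν : U := (InnerProductSpace.toDual ℝ U).symm (l.comp (ContinuousLinearMap.inl ℝ U ℝ)) with hν
  set τ : ℝ := l (0, 1) with hτ
  have hlv : ∀ w t, l (w, t) = inner ℝ ν w + τ * t := by
    intro w t
    rw [hν, InnerProductSpace.toDual_symm_apply]
    have : (w, t) = (w, (0 : ℝ)) + t • ((0 : U), (1 : ℝ)) := by simp
    rw [this, map_add, map_smul, smul_eq_mul, mul_comm]
    simp [hτ]
  have hge : ∀ x ∈ D, ∀ w t, ‖L x - y - w‖ ≤ ε → φ x - φ xs < t → 0 ≤ inner ℝ ν w + τ * t := by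
    intro x hx w t hw ht
    rw [← hlv]
    exact hl _ ⟨x, hx, hw, ht⟩
  have hτ0 : 0 ≤ τ := by
    by_contra! hneg
    -- `t` is chosen so large that `τ * t` outweighs the inner product, were `τ` negative.
    have h := hge xs hxs (L xs - y) ((|inner ℝ ν (L xs - y)| + 1) / (-τ)) (by simpa using hε)
      (by rw [sub_self]; exact div_pos (by positivity) (by linarith))
    have e : τ * ((|inner ℝ ν (L xs - y)| + 1) / (-τ)) = -(|inner ℝ ν (L xs - y)| + 1) := by
      rw [div_neg, mul_neg, mul_div_cancel₀ _ hneg.ne]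
    rw [e] at h
    linarith [le_abs_self (inner ℝ ν (L xs - y))]
  have hτpos : 0 < τ := by
    refine hτ0.lt_of_ne fun hz => ?_
    obtain ⟨w, t⟩ := c₁
    obtain ⟨x, hx, hw, -⟩ := hc₁
    simp only at hw
    rw [hlv, ← hz, zero_mul, add_zero] at hlc₁
    -- If `τ = 0`, the separation is by `ν` alone and strict at `w`. The qualification shows that
    -- `-δ w` is also an admissible perturbation, which contradicts nonnegativity. Here separation
    -- must be proper: a merely nonzero functional could vanish on `C`.
    suffices hs : ∃ δ : ℝ, 0 < δ ∧ ∃ x' ∈ D, ‖L x' - y - (-(δ • w))‖ ≤ ε by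
      obtain ⟨δ, hδ, x', hx', h⟩ := hs
      have := hge x' hx' _ (φ x' - φ xs + 1) h (by linarith)
      rw [← hz, zero_mul, add_zero, inner_neg_right, real_inner_smul_right] at this
      nlinarith [mul_pos hδ hlc₁]
    obtain ⟨x₀, hx₀, h | ⟨rfl, h⟩⟩ := hqual
    · refine ⟨(ε - ‖L x₀ - y‖) / (‖w‖ + 1), div_pos (by linarith) (by positivity), x₀,
        intrinsicInterior_subset hx₀, ?_⟩
      rw [sub_neg_eq_add]
      refine (norm_add_le _ _).trans ?_
      rw [norm_smul, Real.norm_of_nonneg (div_nonneg (by linarith) (by positivity))]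
      have : (ε - ‖L x₀ - y‖) / (‖w‖ + 1) * ‖w‖ ≤ ε - ‖L x₀ - y‖ := by
        rw [div_mul_eq_mul_div, div_le_iff₀ (by positivity)]
        nlinarith [norm_nonneg w]
      linarith
    · obtain ⟨δ, hδ, hmem⟩ := exists_pos_sub_smul_mem_of_mem_intrinsicInterior hx₀ hx
      refine ⟨δ, hδ, _, hmem, ?_⟩
      have h1 : L x₀ = y := sub_eq_zero.1 (norm_eq_zero.1 h)
      have h2 : L x - y - w = 0 := norm_le_zero_iff.1 hw
      have h3 : w = L x - y := (sub_eq_zero.1 h2).symm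
      rw [h3, map_sub, map_smul, map_sub, h1]
      simp
  refine ⟨τ⁻¹ • ν, fun x hx q hq => ?_⟩
  refine le_of_forall_pos_le_add fun η hη => ?_
  have h := hge x hx (L x - y - q) (φ x - φ xs + η) (by simpa using hq) (by linarith)
  rw [real_inner_smul_left]
  have h' : 0 ≤ τ⁻¹ * (inner ℝ ν (L x - y - q) + τ * (φ x - φ xs + η)) := by positivity
  rw [mul_add, inv_mul_cancel_left₀ hτpos.ne'] at h'
  linarith

/-! ### Proximal operators of extended-valued convex functions -/

section Prox

variable {E : Type*} [NormedAddCommGroup E]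

theorem IsClosedProperConvex.coe_toReal [NormedSpace ℝ E] {f : E → EReal}
    (hf : IsClosedProperConvex f) {x : E} (hx : x ∈ effDom f) : ((f x).toReal : EReal) = f x :=
  EReal.coe_toReal hx (hf.ne_bot x)

theorem IsClosedProperConvex.le_coe_iff [NormedSpace ℝ E] {f : E → EReal}
    (hf : IsClosedProperConvex f) {x : E} {t : ℝ} :
    f x ≤ (t : EReal) ↔ x ∈ effDom f ∧ (f x).toReal ≤ t := by
  constructor
  · intro h
    have hx : x ∈ effDom f := fun h' => by
      rw [h', top_le_iff] at h
      exact EReal.coe_ne_top t h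
    refine ⟨hx, ?_⟩
    rwa [← hf.coe_toReal hx, EReal.coe_le_coe_iff] at h
  · rintro ⟨hx, h⟩
    rwa [← hf.coe_toReal hx, EReal.coe_le_coe_iff]

theorem IsClosedProperConvex.convexOn [NormedSpace ℝ E] {f : E → EReal}
    (hf : IsClosedProperConvex f) : ConvexOn ℝ (effDom f) fun x => (f x).toReal := by
  have key : ∀ x ∈ effDom f, ∀ y ∈ effDom f, ∀ a b : ℝ, 0 ≤ a → 0 ≤ b → a + b = 1 →
      a • x + b • y ∈ effDom f ∧
        (f (a • x + b • y)).toReal ≤ a • (f x).toReal + b • (f y).toReal := by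
    intro x hx y hy a b ha hb hab
    have hx' : (x, (f x).toReal) ∈ {q : E × ℝ | f q.1 ≤ (q.2 : EReal)} := (hf.coe_toReal hx).ge
    have hy' : (y, (f y).toReal) ∈ {q : E × ℝ | f q.1 ≤ (q.2 : EReal)} := (hf.coe_toReal hy).ge
    exact hf.le_coe_iff.1 (hf.convex hx' hy' ha hb hab)
  exact ⟨fun x hx y hy a b ha hb hab => (key x hx y hy a b ha hb hab).1,
    fun x hx y hy a b ha hb hab => (key x hx y hy a b ha hb hab).2⟩

theorem IsClosedProperConvex.isClosed_epigraph [NormedSpace ℝ E] {f : E → EReal}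
    (hf : IsClosedProperConvex f) : IsClosed {q : E × ℝ | f q.1 ≤ (q.2 : EReal)} := by
  have h := hf.closed.isClosed_epigraph
  have hc : Continuous fun q : E × ℝ => (q.1, (q.2 : EReal)) :=
    continuous_fst.prodMk (continuous_coe_real_ereal.comp continuous_snd)
  exact h.preimage hc

/-- Separate the epigraph from a point just below the graph. Comparison with the graph point
directly above it shows that the hyperplane is not vertical. -/
theorem IsClosedProperConvex.exists_affine_minorant [NormedSpace ℝ E] {f : E → EReal}
    (hf : IsClosedProperConvex f) :
    ∃ (l : StrongDual ℝ E) (α : ℝ), ∀ x (t : ℝ), f x ≤ (t : EReal) → l x + α ≤ t := by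
  obtain ⟨x₀, hx₀⟩ := hf.exists_ne_top
  have hmem : ∀ x ∈ effDom f, (x, (f x).toReal) ∈ {q : E × ℝ | f q.1 ≤ (q.2 : EReal)} :=
    fun x hx => (hf.coe_toReal hx).ge
  have hnot : (x₀, (f x₀).toReal - 1) ∉ {q : E × ℝ | f q.1 ≤ (q.2 : EReal)} := by
    intro h
    have := (hf.le_coe_iff.1 h).2
    linarith
  obtain ⟨g, u, hlt, hgt⟩ := geometric_hahn_banach_point_closed hf.convex hf.isClosed_epigraph hnot
  have hg : ∀ x t, g (x, t) = g.comp (ContinuousLinearMap.inl ℝ E ℝ) x + t * g (0, 1) := by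
    intro x t
    have : (x, t) = (x, (0 : ℝ)) + t • ((0 : E), (1 : ℝ)) := by simp
    rw [this, map_add, map_smul, smul_eq_mul]
    simp
  have h1 := hgt _ (hmem x₀ hx₀)
  rw [hg] at hlt h1
  set τ := g (0, 1) with hτ
  have hτpos : 0 < τ := by linarith
  refine ⟨-(τ⁻¹ • g.comp (ContinuousLinearMap.inl ℝ E ℝ)), τ⁻¹ * u, fun x t hx => ?_⟩
  have h2 := hgt (x, t) hx
  rw [hg] at h2
  have h3 : τ⁻¹ * u ≤ τ⁻¹ * (g.comp (ContinuousLinearMap.inl ℝ E ℝ) x + t * τ) := by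
    gcongr
  rw [mul_add, mul_comm t τ, inv_mul_cancel_left₀ hτpos.ne'] at h3
  rw [neg_apply, smul_apply, smul_eq_mul]
  linarith

theorem isProx_mul_iff [NormedSpace ℝ E] {f : E → EReal} (hf : IsClosedProperConvex f) {c : ℝ}
    (hc : 0 < c) {ζ z : E} :
    IsProx (fun x => (c : EReal) * f x) ζ z ↔ z ∈ effDom f ∧ ∀ w ∈ effDom f,
      c * (f z).toReal + 1 / 2 * ‖z - ζ‖ ^ 2 ≤ c * (f w).toReal + 1 / 2 * ‖w - ζ‖ ^ 2 := by
  have htop : ∀ w, w ∉ effDom f →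
      (c : EReal) * f w + ((1 / 2 * ‖w - ζ‖ ^ 2 : ℝ) : EReal) = ⊤ := by
    intro w hw
    rw [not_not.1 hw, EReal.coe_mul_top_of_pos hc, EReal.top_add_coe]
  have hcoe : ∀ w, w ∈ effDom f → (c : EReal) * f w + ((1 / 2 * ‖w - ζ‖ ^ 2 : ℝ) : EReal)
      = ((c * (f w).toReal + 1 / 2 * ‖w - ζ‖ ^ 2 : ℝ) : EReal) := by
    intro w hw
    rw [EReal.coe_add (c * _), EReal.coe_mul c, hf.coe_toReal hw]
  constructor
  · intro h
    have hz : z ∈ effDom f := by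
      by_contra hz
      obtain ⟨x₀, hx₀⟩ := hf.exists_ne_top
      have h1 := h x₀
      simp only at h1
      rw [htop z hz, hcoe x₀ hx₀, top_le_iff] at h1
      exact EReal.coe_ne_top _ h1
    refine ⟨hz, fun w hw => ?_⟩
    have h1 := h w
    simp only at h1
    rwa [hcoe z hz, hcoe w hw, EReal.coe_le_coe_iff] at h1
  · rintro ⟨hz, h⟩ w
    simp only
    by_cases hw : w ∈ effDom f
    · rw [hcoe z hz, hcoe w hw, EReal.coe_le_coe_iff]
      exact h w hw
    · rw [htop w hw]
      exact le_top

end Prox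

section ProxInner

variable {E : Type*} [NormedAddCommGroup E] [InnerProductSpace ℝ E]
  {f : E → EReal} {c : ℝ}

/-- The variational inequality which characterizes the proximal point. -/
theorem isProx_mul_iff_inner (hf : IsClosedProperConvex f) (hc : 0 < c) {ζ z : E} :
    IsProx (fun x => (c : EReal) * f x) ζ z ↔ z ∈ effDom f ∧ ∀ w ∈ effDom f,
      inner ℝ (ζ - z) (w - z) ≤ c * ((f w).toReal - (f z).toReal) := by
  rw [isProx_mul_iff hf hc]
  refine and_congr_right fun hz => ⟨fun h w hw => ?_, fun h w hw => ?_⟩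
  -- Compare `z` with `(1 - t) z + t w`, divide by `t`, and let `t` decrease to zero.
  · have key : ∀ t : ℝ, 0 < t → t < 1 → inner ℝ (ζ - z) (w - z)
        ≤ c * ((f w).toReal - (f z).toReal) + t * (1 / 2 * ‖w - z‖ ^ 2) := by
      intro t ht ht1
      have hmem := hf.convexOn.1 hz hw (by linarith : 0 ≤ 1 - t) ht.le (by ring)
      have h1 := hf.convexOn.2 hz hw (by linarith : 0 ≤ 1 - t) ht.le (by ring)
      have h2 := h _ hmem
      have e : (1 - t) • z + t • w - ζ = (z - ζ) + t • (w - z) := by module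
      rw [e, norm_add_sq_real, real_inner_smul_right, norm_smul, mul_pow, Real.norm_eq_abs,
        sq_abs, ← neg_sub ζ z, inner_neg_left] at h2
      simp only [smul_eq_mul] at h1
      have h3 := mul_le_mul_of_nonneg_left h1 hc.le
      have h4 : t * inner ℝ (ζ - z) (w - z)
          ≤ t * (c * ((f w).toReal - (f z).toReal) + t * (1 / 2 * ‖w - z‖ ^ 2)) := by
        nlinarith
      exact le_of_mul_le_mul_left h4 ht
    have hlim : Tendsto (fun t : ℝ => c * ((f w).toReal - (f z).toReal)
        + t * (1 / 2 * ‖w - z‖ ^ 2)) (𝓝[>] 0) (𝓝 (c * ((f w).toReal - (f z).toReal))) := by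
      have : Continuous fun t : ℝ => c * ((f w).toReal - (f z).toReal)
        + t * (1 / 2 * ‖w - z‖ ^ 2) := by fun_prop
      have := (this.tendsto 0).mono_left (nhdsWithin_le_nhds (s := Set.Ioi 0))
      simpa using this
    refine ge_of_tendsto hlim ?_
    filter_upwards [Ioo_mem_nhdsGT (zero_lt_one' ℝ)] with t ht using key t ht.1 ht.2
  · have h1 := h w hw
    have e : w - ζ = (w - z) - (ζ - z) := by module
    rw [e, norm_sub_sq_real (w - z), ← norm_neg (z - ζ), neg_sub, real_inner_comm]
    nlinarith [sq_nonneg ‖w - z‖]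

theorem IsProx.norm_sub_sq_le_inner (hf : IsClosedProperConvex f) (hc : 0 < c) {ζ₁ ζ₂ z₁ z₂ : E}
    (h₁ : IsProx (fun x => (c : EReal) * f x) ζ₁ z₁)
    (h₂ : IsProx (fun x => (c : EReal) * f x) ζ₂ z₂) :
    ‖z₁ - z₂‖ ^ 2 ≤ inner ℝ (z₁ - z₂) (ζ₁ - ζ₂) := by
  rw [isProx_mul_iff_inner hf hc] at h₁ h₂
  have a := h₁.2 z₂ h₂.1
  have b := h₂.2 z₁ h₁.1
  have e : inner ℝ (ζ₁ - z₁) (z₂ - z₁) + inner ℝ (ζ₂ - z₂) (z₁ - z₂)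
      = ‖z₁ - z₂‖ ^ 2 - inner ℝ (z₁ - z₂) (ζ₁ - ζ₂) := by
    rw [← neg_sub z₁ z₂, inner_neg_right, ← real_inner_self_eq_norm_sq,
      real_inner_comm (ζ₁ - ζ₂), ← sub_eq_zero]
    simp only [inner_sub_left]
    ring
  linarith

/-- Minimizing over the epigraph replaces the lower semicontinuous objective by the continuous `Ψ`.
The quadratic term beats the affine minorant, so a sublevel set is compact. -/
theorem exists_isProx_mul [FiniteDimensional ℝ E] (hf : IsClosedProperConvex f) (hc : 0 < c) (ζ : E) :
    ∃ z, IsProx (fun x => (c : EReal) * f x) ζ z := by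
  have : ProperSpace E := FiniteDimensional.proper ℝ E
  obtain ⟨x₀, hx₀⟩ := hf.exists_ne_top
  obtain ⟨l, α, hl⟩ := hf.exists_affine_minorant
  set Ψ : E × ℝ → ℝ := fun q => c * q.2 + 1 / 2 * ‖q.1 - ζ‖ ^ 2 with hΨ
  have cΨ : Continuous Ψ := by fun_prop
  set M := Ψ (x₀, (f x₀).toReal) with hM
  set K : Set (E × ℝ) := {q | f q.1 ≤ (q.2 : EReal)} ∩ {q | Ψ q ≤ M} with hK
  have hKc : IsClosed K := hf.isClosed_epigraph.inter (isClosed_le cΨ continuous_const)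
  have hl' : ∀ x, -(‖l‖ * (‖x - ζ‖ + ‖ζ‖)) ≤ l x := by
    intro x
    have h1 := (abs_le.1 (l.le_opNorm x)).1
    have h2 : ‖x‖ ≤ ‖x - ζ‖ + ‖ζ‖ := by simpa using norm_add_le (x - ζ) ζ
    have h3 := mul_le_mul_of_nonneg_left h2 (norm_nonneg l)
    linarith
  set A := M - c * α + c * ‖l‖ * ‖ζ‖ with hA
  set B := c * ‖l‖ with hB
  have hB0 : 0 ≤ B := by positivity
  -- Beyond this radius, `r² / 2 ≤ A + B * r` fails.
  set R := 2 * B + 2 * |A| + 1 with hR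
  have hKb : K ⊆ Metric.closedBall ζ R ×ˢ Set.Icc (α - ‖l‖ * (R + ‖ζ‖)) (M / c) := by
    rintro ⟨x, t⟩ ⟨hx, hxt⟩
    have h1 := hl x t hx
    have h2 := hl' x
    simp only [hΨ, Set.mem_ofPred_eq] at hxt
    have h3 : c * (-(‖l‖ * (‖x - ζ‖ + ‖ζ‖)) + α) ≤ c * t := by
      gcongr
      linarith
    have hn : ‖x - ζ‖ ≤ R := by
      by_contra! hlt
      have h4 : 1 / 2 * ‖x - ζ‖ ^ 2 ≤ A + B * ‖x - ζ‖ := by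
        rw [hA, hB]
        nlinarith
      have h5 : 1 ≤ ‖x - ζ‖ := by linarith [abs_nonneg A]
      nlinarith [le_abs_self A, abs_nonneg A]
    refine ⟨by simpa [dist_eq_norm] using hn, ?_, ?_⟩
    · have : ‖l‖ * (‖x - ζ‖ + ‖ζ‖) ≤ ‖l‖ * (R + ‖ζ‖) := by gcongr
      simp only
      linarith
    · simp only
      rw [le_div_iff₀ hc]
      nlinarith [sq_nonneg ‖x - ζ‖]
  have hKcomp : IsCompact K :=
    ((isCompact_closedBall ζ R).prod isCompact_Icc).of_isClosed_subset hKc hKb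
  have hK₀ : (x₀, (f x₀).toReal) ∈ K := ⟨(hf.coe_toReal hx₀).ge, le_refl M⟩
  obtain ⟨⟨z, t⟩, ⟨hz, hzM⟩, hmin⟩ := hKcomp.exists_isMinOn ⟨_, hK₀⟩ cΨ.continuousOn
  have hz' := hf.le_coe_iff.1 hz
  refine ⟨z, (isProx_mul_iff hf hc).2 ⟨hz'.1, fun w hw => ?_⟩⟩
  have h1 : c * (f z).toReal ≤ c * t := by
    gcongr
    exact hz'.2
  have h2 : Ψ (z, t) ≤ Ψ (w, (f w).toReal) := by
    by_cases hwM : Ψ (w, (f w).toReal) ≤ M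
    · exact hmin ⟨(hf.coe_toReal hw).ge, hwM⟩
    · exact le_trans hzM (not_le.1 hwM).le
  simp only [hΨ] at h2
  linarith

theorem isProx_prox_mul [FiniteDimensional ℝ E] (hf : IsClosedProperConvex f) (hc : 0 < c) (ζ : E) :
    IsProx (fun x => (c : EReal) * f x) ζ (prox (fun x => (c : EReal) * f x) ζ) :=
  Classical.epsilon_spec (exists_isProx_mul hf hc ζ)

theorem norm_sub_sq_prox_mul_le_inner [FiniteDimensional ℝ E] (hf : IsClosedProperConvex f)
    (hc : 0 < c) (ζ₁ ζ₂ : E) :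
    ‖prox (fun x => (c : EReal) * f x) ζ₁ - prox (fun x => (c : EReal) * f x) ζ₂‖ ^ 2 ≤
      inner ℝ (prox (fun x => (c : EReal) * f x) ζ₁ - prox (fun x => (c : EReal) * f x) ζ₂)
        (ζ₁ - ζ₂) :=
  IsProx.norm_sub_sq_le_inner hf hc (isProx_prox_mul hf hc ζ₁) (isProx_prox_mul hf hc ζ₂)

theorem IsProx.prox_mul_eq [FiniteDimensional ℝ E] (hf : IsClosedProperConvex f) (hc : 0 < c) {ζ z : E}
    (h : IsProx (fun x => (c : EReal) * f x) ζ z) : prox (fun x => (c : EReal) * f x) ζ = z := by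
  have := IsProx.norm_sub_sq_le_inner hf hc (isProx_prox_mul hf hc ζ) h
  rw [sub_self, inner_zero_right] at this
  have h0 : ‖prox (fun x => (c : EReal) * f x) ζ - z‖ = 0 := by
    nlinarith [norm_nonneg (prox (fun x => (c : EReal) * f x) ζ - z)]
  exact sub_eq_zero.1 (norm_eq_zero.1 h0)

end ProxInner

/-! ### Flows on a connected graph -/

/-- On a connected graph every divergence with zero sum is the divergence of a flow. -/
theorem exists_antisymm_flow {ι V : Type*} [Fintype ι] [DecidableEq ι] [AddCommGroup V]
    {G : SimpleGraph ι} [DecidableRel G.Adj] (hG : G.Connected) (h : ι → V) (hsum : ∑ i, h i = 0) :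
    ∃ w : ι → ι → V, (∀ i j, w j i = -w i j) ∧ ∀ i, ∑ j ∈ G.neighborFinset i, w i j = h i := by
  -- Realizable divergences form a group. It contains the unit transfers along edges, hence along
  -- walks, and these generate all zero-sum families.
  let S : AddSubgroup (ι → V) :=
    { carrier := {h | ∃ w : ι → ι → V, (∀ i j, w j i = -w i j) ∧
        ∀ i, ∑ j ∈ G.neighborFinset i, w i j = h i}
      zero_mem' := ⟨0, by simp, by simp⟩
      add_mem' := by
        rintro a b ⟨w, hw, hwa⟩ ⟨w', hw', hwb⟩
        refine ⟨w + w', fun i j => ?_, fun i => ?_⟩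
        · simp only [Pi.add_apply, hw i j, hw' i j]
          abel
        · simp only [Pi.add_apply, Finset.sum_add_distrib, hwa, hwb]
      neg_mem' := by
        rintro a ⟨w, hw, hwa⟩
        refine ⟨-w, fun i j => ?_, fun i => ?_⟩
        · simp only [Pi.neg_apply, hw i j]
        · simp only [Pi.neg_apply, Finset.sum_neg_distrib, hwa] }
  have hadj : ∀ (v : V) (s t : ι), G.Adj s t → Pi.single s v - Pi.single t v ∈ S := by
    intro v s t hst
    refine ⟨fun i j => (if i = s ∧ j = t then v else 0) - (if i = t ∧ j = s then v else 0),
      fun i j => ?_, fun i => ?_⟩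
    · simp only [and_comm]
      abel
    · simp only [Finset.sum_sub_distrib, Pi.sub_apply]
      congr 1
      · by_cases hi : i = s
        · subst hi
          simp [Finset.sum_ite_eq', hst]
        · simp [hi]
      · by_cases hi : i = t
        · subst hi
          simp [Finset.sum_ite_eq', hst.symm]
        · simp [hi]
  have hreach : ∀ (v : V) (s t : ι), Pi.single s v - Pi.single t v ∈ S := by
    intro v s t
    obtain ⟨p⟩ := hG.preconnected s t
    induction p with
    | nil => simp
    | cons hst _ ih => simpa using S.add_mem (hadj v _ _ hst) ih
  obtain ⟨o⟩ := hG.nonempty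
  have hS : h ∈ S := by
    have e : h = ∑ i, (Pi.single i (h i) - Pi.single o (h i)) := by
      rw [Finset.sum_sub_distrib, Finset.univ_sum_single]
      have : ∑ i, (Pi.single o (h i) : ι → V) = Pi.single o (∑ i, h i) := by
        ext k
        by_cases hk : k = o
        · subst hk
          simp
        · simp [hk]
      rw [this, hsum, Pi.single_zero, sub_zero]
    rw [e]
    exact S.sum_mem fun i _ => hreach (h i) i o
  exact hS

/-! ### Projections onto closed convex sets -/

/-- The projection onto a closed convex set. -/
theorem exists_convex_projection {H : Type*} [NormedAddCommGroup H] [InnerProductSpace ℝ H]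
    [CompleteSpace H] {K : Set H} (hne : K.Nonempty) (hcl : IsClosed K) (hK : Convex ℝ K) :
    ∃ J : H → H, (∀ x, J x ∈ K) ∧ ∀ x, ∀ w ∈ K, inner ℝ (x - J x) (w - J x) ≤ 0 := by
  choose J hJ hJ' using fun x => exists_norm_eq_iInf_of_complete_convex hne hcl.isComplete hK x
  exact ⟨J, hJ, fun x => (norm_eq_iInf_iff_real_inner_le_zero hK (hJ x)).1 (hJ' x)⟩

section Projection

variable {H : Type*} [NormedAddCommGroup H] [InnerProductSpace ℝ H] {K : Set H} {J : H → H}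

theorem firmlyNonexpansive_of_projection (hJ : ∀ x, J x ∈ K)
    (hJ' : ∀ x, ∀ w ∈ K, inner ℝ (x - J x) (w - J x) ≤ 0) : FirmlyNonexpansive J := by
  intro x y
  have a := hJ' x _ (hJ y)
  have b := hJ' y _ (hJ x)
  rw [← neg_sub (J x) (J y), inner_neg_right] at a
  have e : inner ℝ (y - J y) (J x - J y) - inner ℝ (x - J x) (J x - J y)
      = ‖J x - J y‖ ^ 2 - inner ℝ (J x - J y) (x - y) := by
    rw [← real_inner_self_eq_norm_sq, real_inner_comm (x - y)]
    simp only [inner_sub_left]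
    ring
  linarith

theorem norm_sub_sq_add_le_of_projection
    (hJ' : ∀ x, ∀ w ∈ K, inner ℝ (x - J x) (w - J x) ≤ 0) (x : H) {w : H} (hw : w ∈ K) :
    ‖x - J x‖ ^ 2 + ‖w - J x‖ ^ 2 ≤ ‖x - w‖ ^ 2 := by
  have a := hJ' x w hw
  have e : x - w = (x - J x) - (w - J x) := by module
  rw [e, norm_sub_sq_real (x - J x)]
  linarith

theorem projection_eq_of_inner_le (hJ : ∀ x, J x ∈ K)
    (hJ' : ∀ x, ∀ w ∈ K, inner ℝ (x - J x) (w - J x) ≤ 0) {x q : H} (hq : q ∈ K)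
    (h : ∀ w ∈ K, ‖x - q‖ ^ 2 ≤ ‖x - w‖ ^ 2) : J x = q := by
  have a := norm_sub_sq_add_le_of_projection hJ' x hq
  have b := h _ (hJ x)
  have h0 : ‖q - J x‖ = 0 := by nlinarith [norm_nonneg (q - J x)]
  exact (sub_eq_zero.1 (norm_eq_zero.1 h0)).symm

end Projection

/-! ### The space of arcs, the edge operator and the agents' constraint set -/

section Network

set_option linter.unusedSectionVars false

variable {ι : Type*} [Fintype ι] {G : SimpleGraph ι} [DecidableRel G.Adj] {U V : Type*}

theorem sum_neighborFinset_comm {M : Type*} [AddCommMonoid M] (g : ι → ι → M) :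
    ∑ i, ∑ j ∈ G.neighborFinset i, g i j = ∑ i, ∑ j ∈ G.neighborFinset i, g j i :=
  Finset.sum_comm' fun i j => by simp [G.adj_comm]

/-- Each arc is paired with its reversal; the inequalities used below hold for such pairs but not
arc by arc. -/
theorem sum_neighborFinset_le_of_symm {g h : ι → ι → ℝ}
    (hgh : ∀ i j, G.Adj i j → g i j + g j i ≤ h i j + h j i) :
    ∑ i, ∑ j ∈ G.neighborFinset i, g i j ≤ ∑ i, ∑ j ∈ G.neighborFinset i, h i j := by
  have key : ∑ i, ∑ j ∈ G.neighborFinset i, (g i j + g j i)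
      ≤ ∑ i, ∑ j ∈ G.neighborFinset i, (h i j + h j i) :=
    Finset.sum_le_sum fun i _ => Finset.sum_le_sum fun j hj => hgh i j (by simpa using hj)
  simp only [Finset.sum_add_distrib] at key
  rw [← sum_neighborFinset_comm g, ← sum_neighborFinset_comm h] at key
  linarith

variable (G) in
/-- The arcs `(i, j)` of the network, with `i` and `j` neighbors. -/
abbrev Arc : Type _ := Σ i, G.neighborSet i

/-- The reversed arc. -/
def Arc.swap (d : Arc G) : Arc G := ⟨d.2, d.1, d.2.2.symm⟩

theorem sum_arc {M : Type*} [AddCommMonoid M] (g : ι → ι → M) :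
    ∑ d : Arc G, g d.1 d.2 = ∑ i, ∑ j ∈ G.neighborFinset i, g i j := by
  rw [Fintype.sum_sigma]
  refine Finset.sum_congr rfl fun i _ => ?_
  rw [Finset.sum_subtype (p := fun j => j ∈ G.neighborSet i) _ (fun j => by simp)]

variable [NormedAddCommGroup U] [InnerProductSpace ℝ U] [NormedAddCommGroup V]
  [InnerProductSpace ℝ V]

variable (G U V) in
/-- Families of pairs of vectors, indexed by the arcs of the network. -/
abbrev ArcSpace : Type _ := PiLp 2 fun _ : Arc G => WithLp 2 (U × V)

variable (G) in
/-- The point of `ArcSpace` with entries `(a i j, b i j)`. -/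
def arcMk (a : ι → ι → U) (b : ι → ι → V) : ArcSpace G U V :=
  WithLp.toLp 2 fun d => WithLp.toLp 2 (a d.1 d.2, b d.1 d.2)

@[simp] theorem arcMk_fst (a : ι → ι → U) (b : ι → ι → V) (d : Arc G) :
    (arcMk G a b d).fst = a d.1 d.2 := rfl

@[simp] theorem arcMk_snd (a : ι → ι → U) (b : ι → ι → V) (d : Arc G) :
    (arcMk G a b d).snd = b d.1 d.2 := rfl

theorem arcSpace_ext {x x' : ArcSpace G U V} (h₁ : ∀ d, (x d).fst = (x' d).fst)
    (h₂ : ∀ d, (x d).snd = (x' d).snd) : x = x' := by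
  refine PiLp.ext fun d => ?_
  apply (WithLp.equiv 2 (U × V)).injective
  exact Prod.ext (h₁ d) (h₂ d)

theorem arcMk_congr {a a' : ι → ι → U} {b b' : ι → ι → V} (h₁ : ∀ i j, G.Adj i j → a i j = a' i j)
    (h₂ : ∀ i j, G.Adj i j → b i j = b' i j) : arcMk G a b = arcMk G a' b' :=
  arcSpace_ext (fun d => h₁ d.1 d.2 d.2.2) fun d => h₂ d.1 d.2 d.2.2

theorem arcMk_add (a a' : ι → ι → U) (b b' : ι → ι → V) :
    arcMk G a b + arcMk G a' b' = arcMk G (a + a') (b + b') := rfl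

theorem arcMk_sub (a a' : ι → ι → U) (b b' : ι → ι → V) :
    arcMk G a b - arcMk G a' b' = arcMk G (a - a') (b - b') := rfl

theorem smul_arcMk (t : ℝ) (a : ι → ι → U) (b : ι → ι → V) :
    t • arcMk G a b = arcMk G (t • a) (t • b) := rfl

theorem exists_eq_arcMk (x : ArcSpace G U V) : ∃ a b, x = arcMk G a b := by
  classical
  refine ⟨fun i j => if h : G.Adj i j then (x ⟨i, j, h⟩).fst else 0,
    fun i j => if h : G.Adj i j then (x ⟨i, j, h⟩).snd else 0, arcSpace_ext ?_ ?_⟩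
  · rintro ⟨i, j, h⟩
    simp [(show G.Adj i j from h)]
  · rintro ⟨i, j, h⟩
    simp [(show G.Adj i j from h)]

theorem inner_arcMk (a a' : ι → ι → U) (b b' : ι → ι → V) :
    inner ℝ (arcMk G a b) (arcMk G a' b')
      = ∑ i, ∑ j ∈ G.neighborFinset i, (inner ℝ (a i j) (a' i j) + inner ℝ (b i j) (b' i j)) := by
  rw [← sum_arc fun i j => inner ℝ (a i j) (a' i j) + inner ℝ (b i j) (b' i j), PiLp.inner_apply]
  rfl

theorem norm_sq_arcMk (a : ι → ι → U) (b : ι → ι → V) :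
    ‖arcMk G a b‖ ^ 2 = ∑ i, ∑ j ∈ G.neighborFinset i, (‖a i j‖ ^ 2 + ‖b i j‖ ^ 2) := by
  rw [← real_inner_self_eq_norm_sq, inner_arcMk]
  simp only [real_inner_self_eq_norm_sq]

variable (G U) in
/-- The map `(a, b) ↦ ((a_ij - a_ji) / 2, P ((b_ij + b_ji) / 2))`. -/
def edgeMap (P : V → V) (x : ArcSpace G U V) : ArcSpace G U V :=
  WithLp.toLp 2 fun d => WithLp.toLp 2 ((1 / 2 : ℝ) • ((x d).fst - (x d.swap).fst),
    P ((1 / 2 : ℝ) • ((x d).snd + (x d.swap).snd)))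

theorem edgeMap_arcMk (P : V → V) (a : ι → ι → U) (b : ι → ι → V) :
    edgeMap G U P (arcMk G a b) = arcMk G (fun i j => (1 / 2 : ℝ) • (a i j - a j i))
      (fun i j => P ((1 / 2 : ℝ) • (b i j + b j i))) := rfl

/-- On a pair of opposite arcs, the `a` part is an orthogonal projection and gives equality, while
the `b` part is twice the inequality for `P` at the averages. -/
theorem firmlyNonexpansive_edgeMap {P : V → V} (hP : FirmlyNonexpansive P) :
    FirmlyNonexpansive (edgeMap G U P) := by
  intro x x'
  obtain ⟨a, b, rfl⟩ := exists_eq_arcMk x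
  obtain ⟨a', b', rfl⟩ := exists_eq_arcMk x'
  rw [edgeMap_arcMk, edgeMap_arcMk, arcMk_sub, arcMk_sub, norm_sq_arcMk, inner_arcMk]
  refine sum_neighborFinset_le_of_symm fun i j _ => ?_
  simp only [Pi.sub_apply]
  have h := hP ((1 / 2 : ℝ) • (b i j + b j i)) ((1 / 2 : ℝ) • (b' i j + b' j i))
  rw [add_comm (b j i), add_comm (b' j i)]
  generalize P ((1 / 2 : ℝ) • (b i j + b j i)) - P ((1 / 2 : ℝ) • (b' i j + b' j i)) = B at *
  have eB : (1 / 2 : ℝ) • (b i j + b j i) - (1 / 2 : ℝ) • (b' i j + b' j i)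
      = (1 / 2 : ℝ) • ((b i j - b' i j) + (b j i - b' j i)) := by module
  rw [eB, real_inner_smul_right, inner_add_right] at h
  obtain ⟨u, hu⟩ : ∃ u, u = a i j - a' i j := ⟨_, rfl⟩
  obtain ⟨v, hv⟩ : ∃ v, v = a j i - a' j i := ⟨_, rfl⟩
  have e1 : (1 / 2 : ℝ) • (a i j - a j i) - (1 / 2 : ℝ) • (a' i j - a' j i)
      = (1 / 2 : ℝ) • (u - v) := by rw [hu, hv]; module
  have e2 : (1 / 2 : ℝ) • (a j i - a i j) - (1 / 2 : ℝ) • (a' j i - a' i j)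
      = -((1 / 2 : ℝ) • (u - v)) := by rw [hu, hv]; module
  rw [e1, e2, ← hu, ← hv, norm_neg, inner_neg_left, real_inner_smul_left, real_inner_smul_left,
    norm_smul, mul_pow, Real.norm_of_nonneg (by norm_num), norm_sub_sq_real, inner_sub_left,
    inner_sub_left, real_inner_self_eq_norm_sq, real_inner_self_eq_norm_sq, real_inner_comm u v]
  linarith

variable (G) in
/-- The points of `ArcSpace` which satisfy the constraints of all agents. -/
def agentSet (L : ι → V →ₗ[ℝ] U) (y : ι → U) (η : ℝ) : Set (ArcSpace G U V) :=
  {x | (∀ d e : Arc G, d.1 = e.1 → (x d).snd = (x e).snd) ∧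
    ∀ d : Arc G, ‖L d.1 (x d).snd - y d.1 + ∑ j : G.neighborSet d.1, (x ⟨d.1, j⟩).fst‖ ≤ η}

variable {L : ι → V →ₗ[ℝ] U} {y : ι → U} {η : ℝ}

theorem sum_neighborSet_arcMk_fst (a : ι → ι → U) (b : ι → ι → V) (i : ι) :
    ∑ j : G.neighborSet i, (arcMk G a b ⟨i, j⟩).fst = ∑ j ∈ G.neighborFinset i, a i j := by
  rw [Finset.sum_subtype (p := fun j => j ∈ G.neighborSet i) _ (fun j => by simp)]
  rfl

/-- Constraints in `agentSet` are indexed by arcs, so an agent without neighbors would escape its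
own; `hnbr` excludes this. -/
theorem arcMk_mem_agentSet (hnbr : ∀ i, ∃ j, G.Adj i j) {a : ι → ι → U} {β : ι → V} :
    arcMk G a (fun i _ => β i) ∈ agentSet G L y η ↔
      ∀ i, ‖L i (β i) - y i + ∑ j ∈ G.neighborFinset i, a i j‖ ≤ η := by
  constructor
  · rintro ⟨-, h⟩ i
    obtain ⟨j, hj⟩ := hnbr i
    have := h ⟨i, j, hj⟩
    rwa [sum_neighborSet_arcMk_fst] at this
  · intro h
    refine ⟨?_, fun d => ?_⟩
    · rintro ⟨i, j⟩ ⟨i', j'⟩ (rfl : i = i')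
      rfl
    · rw [sum_neighborSet_arcMk_fst]
      exact h d.1

theorem exists_eq_arcMk_of_mem_agentSet (hnbr : ∀ i, ∃ j, G.Adj i j) {x : ArcSpace G U V}
    (hx : x ∈ agentSet G L y η) : ∃ (a : ι → ι → U) (β : ι → V), x = arcMk G a fun i _ => β i := by
  obtain ⟨a, b, rfl⟩ := exists_eq_arcMk x
  choose j hj using hnbr
  refine ⟨a, fun i => b i (j i), arcMk_congr (fun _ _ _ => rfl) fun i k hk => ?_⟩
  exact hx.1 ⟨i, k, hk⟩ ⟨i, j i, hj i⟩ rfl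

theorem convex_agentSet : Convex ℝ (agentSet G L y η) := by
  rintro x ⟨hx₁, hx₂⟩ x' ⟨hx'₁, hx'₂⟩ s t hs ht hst
  refine ⟨fun d e hde => ?_, fun d => ?_⟩
  · change s • (x d).snd + t • (x' d).snd = s • (x e).snd + t • (x' e).snd
    rw [hx₁ d e hde, hx'₁ d e hde]
  · change ‖L d.1 (s • (x d).snd + t • (x' d).snd) - y d.1
      + ∑ j : G.neighborSet d.1, (s • (x ⟨d.1, j⟩).fst + t • (x' ⟨d.1, j⟩).fst)‖ ≤ η
    have e : L d.1 (s • (x d).snd + t • (x' d).snd) - y d.1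
        + ∑ j : G.neighborSet d.1, (s • (x ⟨d.1, j⟩).fst + t • (x' ⟨d.1, j⟩).fst)
        = s • (L d.1 (x d).snd - y d.1 + ∑ j : G.neighborSet d.1, (x ⟨d.1, j⟩).fst)
        + t • (L d.1 (x' d).snd - y d.1 + ∑ j : G.neighborSet d.1, (x' ⟨d.1, j⟩).fst) := by
      have : y d.1 = (s + t) • y d.1 := by rw [hst, one_smul]
      rw [Finset.sum_add_distrib, ← Finset.smul_sum, ← Finset.smul_sum, map_add, map_smul, map_smul]
      nth_rewrite 1 [this]
      module
    rw [e]
    refine (norm_add_le _ _).trans ?_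
    rw [norm_smul, norm_smul, Real.norm_of_nonneg hs, Real.norm_of_nonneg ht]
    calc _ ≤ s * η + t * η := by gcongr <;> [exact hx₂ d; exact hx'₂ d]
      _ = η := by rw [← add_mul, hst, one_mul]

theorem isClosed_agentSet [FiniteDimensional ℝ V] : IsClosed (agentSet G L y η) := by
  have c1 : ∀ d : Arc G, Continuous fun x : ArcSpace G U V => (x d).fst := fun d => by fun_prop
  have c2 : ∀ d : Arc G, Continuous fun x : ArcSpace G U V => (x d).snd := fun d => by fun_prop
  have e : agentSet G L y η = (⋂ (d : Arc G) (e : Arc G) (_ : d.1 = e.1),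
      {x : ArcSpace G U V | (x d).snd = (x e).snd}) ∩ ⋂ d : Arc G, {x : ArcSpace G U V |
        ‖L d.1 (x d).snd - y d.1 + ∑ j : G.neighborSet d.1, (x ⟨d.1, j⟩).fst‖ ≤ η} := by
    ext x
    simp [agentSet]
  rw [e]
  refine IsClosed.inter (isClosed_iInter fun d => isClosed_iInter fun e => isClosed_iInter fun _ =>
    isClosed_eq (c2 d) (c2 e)) (isClosed_iInter fun d => isClosed_le ?_ continuous_const)
  have cL : Continuous (L d.1) := (L d.1).continuous_of_finiteDimensional
  exact (((cL.comp (c2 d)).sub continuous_const).add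
    (continuous_finsetSum _ fun j _ => c1 ⟨d.1, j⟩)).norm

end Network

/-! ### Fixed points and solutions of the global problem -/

section Consensus

set_option linter.unusedSectionVars false

variable {ι : Type*} [Fintype ι] {G : SimpleGraph ι} [DecidableRel G.Adj] {U V : Type*}
  [NormedAddCommGroup U] [InnerProductSpace ℝ U] [NormedAddCommGroup V] [InnerProductSpace ℝ V]
  {L : ι → V →ₗ[ℝ] U} {y : ι → U}

/-- The residual of the global problem can be shared equally between the agents. -/
theorem exists_flow_residual [DecidableEq ι] (hG : G.Connected) (β : V) :
    ∃ a : ι → ι → U, (∀ i j, a j i = -a i j) ∧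
      ∀ i, L i β - y i + ∑ j ∈ G.neighborFinset i, a i j
        = (1 / (Fintype.card ι : ℝ)) • ((∑ i, L i) β - ∑ i, y i) := by
  have hcard : (Fintype.card ι : ℝ) ≠ 0 := by
    have := hG.nonempty
    exact_mod_cast Fintype.card_ne_zero
  obtain ⟨a, ha, hs⟩ := exists_antisymm_flow hG
    (fun i => (1 / (Fintype.card ι : ℝ)) • ((∑ i, L i) β - ∑ i, y i) - (L i β - y i)) (by
      rw [Finset.sum_sub_distrib, Finset.sum_const, Finset.card_univ, ← Nat.cast_smul_eq_nsmul ℝ,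
        smul_smul, mul_one_div_cancel hcard, one_smul, Finset.sum_sub_distrib,
        LinearMap.sum_apply, sub_self])
  exact ⟨a, ha, fun i => by rw [hs i]; abel⟩

theorem exists_flow_mem_agentSet [DecidableEq ι] (hG : G.Connected) (hnbr : ∀ i, ∃ j, G.Adj i j)
    {ε : ℝ} {β : V} (hβ : ‖(∑ i, L i) β - ∑ i, y i‖ ≤ ε) :
    ∃ a : ι → ι → U, (∀ i j, a j i = -a i j) ∧
      arcMk G a (fun _ _ => β) ∈ agentSet G L y (ε / Fintype.card ι) := by
  obtain ⟨a, ha, hs⟩ := exists_flow_residual (L := L) (y := y) hG β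
  refine ⟨a, ha, (arcMk_mem_agentSet hnbr (β := fun _ => β)).2 fun i => ?_⟩
  rw [hs i, norm_smul, Real.norm_of_nonneg (by positivity), one_div_mul_eq_div]
  gcongr

/-- If the agents agree and the exchanged vectors cancel, then the global constraint holds. -/
theorem norm_residual_le_of_antisymm (hG : G.Connected) {ε : ℝ} {a : ι → ι → U} {β : V}
    (ha : ∀ i j, G.Adj i j → a j i = -a i j)
    (h : ∀ i, ‖L i β - y i + ∑ j ∈ G.neighborFinset i, a i j‖ ≤ ε / Fintype.card ι) :
    ‖(∑ i, L i) β - ∑ i, y i‖ ≤ ε := by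
  have hcard : (Fintype.card ι : ℝ) ≠ 0 := by
    have := hG.nonempty
    exact_mod_cast Fintype.card_ne_zero
  have hz : ∑ i, ∑ j ∈ G.neighborFinset i, a i j = 0 := by
    have h1 := sum_neighborFinset_comm (G := G) a
    have h2 : ∑ i, ∑ j ∈ G.neighborFinset i, a j i = -∑ i, ∑ j ∈ G.neighborFinset i, a i j := by
      rw [← Finset.sum_neg_distrib]
      refine Finset.sum_congr rfl fun i _ => ?_
      rw [← Finset.sum_neg_distrib]
      exact Finset.sum_congr rfl fun j hj => ha i j (by simpa using hj)
    have h3 := eq_neg_iff_add_eq_zero.1 (h1.trans h2)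
    rw [← two_smul ℝ] at h3
    exact (smul_eq_zero.1 h3).resolve_left two_ne_zero
  have e : (∑ i, L i) β - ∑ i, y i = ∑ i, (L i β - y i + ∑ j ∈ G.neighborFinset i, a i j) := by
    rw [Finset.sum_add_distrib, hz, add_zero, Finset.sum_sub_distrib, LinearMap.sum_apply]
  rw [e]
  refine (norm_sum_le _ _).trans ((Finset.sum_le_sum fun i _ => h i).trans ?_)
  rw [Finset.sum_const, Finset.card_univ, nsmul_eq_mul, mul_div_cancel₀ _ hcard]

theorem eq_of_forall_adj_eq (hG : G.Connected) {β : ι → V}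
    (h : ∀ i j, G.Adj i j → β i = β j) (i j : ι) : β i = β j := by
  obtain ⟨p⟩ := hG.preconnected i j
  induction p with
  | nil => rfl
  | cons hst _ ih => exact (h _ _ hst).trans ih

variable {D : Set V} {φ : V → ℝ} {c ε : ℝ} {P : V → V} {J : ArcSpace G U V → ArcSpace G U V}

/-- A Lagrange multiplier yields a fixed point of the Douglas–Rachford operator. -/
theorem exists_douglasRachford_fixedPoint [DecidableEq ι] [FiniteDimensional ℝ U]
    [FiniteDimensional ℝ V]
    (hG : G.Connected) (hnbr : ∀ i, ∃ j, G.Adj i j) (hc : 0 < c)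
    (hP : ∀ ζ z, z ∈ D → (∀ w ∈ D, inner ℝ (ζ - z) (w - z) ≤ c * (φ w - φ z)) → P ζ = z)
    (hJ : ∀ x q, q ∈ agentSet G L y (ε / Fintype.card ι) →
      (∀ w ∈ agentSet G L y (ε / Fintype.card ι), inner ℝ (x - q) (w - q) ≤ 0) → J x = q)
    {βs : V} (hβs : βs ∈ D) (hfeas : ‖(∑ i, L i) βs - ∑ i, y i‖ ≤ ε)
    {ν : U} (hν : ∀ β ∈ D, ∀ q : U, ‖q‖ ≤ ε →
      φ βs ≤ φ β + inner ℝ ν ((∑ i, L i) β - ∑ i, y i - q)) :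
    ∃ z, J ((2 : ℝ) • edgeMap G U P z - z) = edgeMap G U P z := by
  have hcard : (0 : ℝ) < Fintype.card ι := by
    have := hG.nonempty
    exact_mod_cast Fintype.card_pos
  set r := (∑ i, L i) βs - ∑ i, y i with hr
  obtain ⟨a, ha, hares⟩ := exists_flow_residual (L := L) (y := y) hG βs
  -- The number of arcs times `c`: the value that makes the divergence prescribed for `w` below sum
  -- to zero.
  set t : ℝ := c * ∑ i, ((G.neighborFinset i).card : ℝ) with ht
  have ht0 : 0 ≤ t :=
    mul_nonneg hc.le (Finset.sum_nonneg fun i _ => Nat.cast_nonneg _)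
  -- Stationarity of the Lagrangian makes `s` a subgradient of `φ` at `βs` relative to `D`.
  set s : V := -LinearMap.adjoint (∑ i, L i) ν with hs
  have hadj : ∑ i, LinearMap.adjoint (L i) ν = -s := by
    rw [hs, neg_neg, map_sum, LinearMap.sum_apply]
  obtain ⟨w, hw, hwdiv⟩ := exists_antisymm_flow hG (fun i => -(t • LinearMap.adjoint (L i) ν)
    - ((G.neighborFinset i).card : ℝ) • c • s) (by
      rw [Finset.sum_sub_distrib, Finset.sum_neg_distrib, ← Finset.smul_sum, ← Finset.sum_smul,
        hadj, ht]
      module)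
  have hPs : P (βs + c • s) = βs := by
    refine hP _ _ hβs fun w hw => ?_
    have h := hν w hw r hfeas
    have e : (∑ i, L i) w - ∑ i, y i - r = (∑ i, L i) (w - βs) := by
      rw [hr, map_sub]
      abel
    rw [e] at h
    rw [add_sub_cancel_left, real_inner_smul_left, hs, inner_neg_left, LinearMap.adjoint_inner_left]
    exact mul_le_mul_of_nonneg_left (by linarith) hc.le
  have hnormal : ∀ q : U, ‖q‖ ≤ ε → inner ℝ ν q ≤ inner ℝ ν r := by
    intro q hq
    have h := hν βs hβs q hq
    rw [inner_sub_right] at h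
    linarith
  set x := arcMk G a (fun _ _ => βs) with hx
  -- Antisymmetry of `w` makes it invisible to `edgeMap`, while its divergence puts `x - z` in the
  -- normal cone of `agentSet` at `x`.
  set z := arcMk G (fun i j => a i j - t • ν) (fun i j => βs + c • s + w i j) with hz
  have hxz : edgeMap G U P z = x := by
    rw [hz, edgeMap_arcMk, hx]
    refine arcMk_congr (fun i j _ => ?_) fun i j _ => ?_
    · rw [ha i j]
      module
    · rw [hw i j]
      convert hPs using 2
      module
  refine ⟨z, ?_⟩
  rw [hxz]
  refine hJ _ _ ?_ fun x' hx' => ?_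
  · refine (arcMk_mem_agentSet hnbr (β := fun _ => βs)).2 fun i => ?_
    rw [hares i, norm_smul, Real.norm_of_nonneg (by positivity), one_div_mul_eq_div]
    gcongr
  obtain ⟨a', β', rfl⟩ := exists_eq_arcMk_of_mem_agentSet hnbr hx'
  have hx'' := (arcMk_mem_agentSet hnbr).1 hx'
  have e1 : (2 : ℝ) • x - z - x = arcMk G (fun _ _ => t • ν) (fun i j => -(c • s + w i j)) := by
    rw [hx, hz, smul_arcMk, arcMk_sub, arcMk_sub]
    refine arcMk_congr (fun i j _ => ?_) fun i j _ => ?_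
    · simp only [Pi.sub_apply, Pi.smul_apply]
      module
    · simp only [Pi.sub_apply, Pi.smul_apply]
      module
  rw [e1, hx, arcMk_sub, inner_arcMk]
  refine Finset.sum_nonpos fun i _ => ?_
  simp only [Pi.sub_apply]
  rw [Finset.sum_add_distrib, ← inner_sum, ← sum_inner, Finset.sum_neg_distrib,
    Finset.sum_add_distrib, Finset.sum_const, hwdiv, ← Nat.cast_smul_eq_nsmul ℝ,
    Finset.sum_sub_distrib]
  have e2 : -(((G.neighborFinset i).card : ℝ) • c • s + (-(t • LinearMap.adjoint (L i) ν)
      - ((G.neighborFinset i).card : ℝ) • c • s)) = t • LinearMap.adjoint (L i) ν := by abel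
  rw [e2, real_inner_smul_left, real_inner_smul_left, LinearMap.adjoint_inner_left, ← mul_add,
    ← inner_add_right]
  refine mul_nonpos_of_nonneg_of_nonpos ht0 ?_
  have e3 : ∑ j ∈ G.neighborFinset i, a' i j - ∑ j ∈ G.neighborFinset i, a i j + L i (β' i - βs)
      = (L i (β' i) - y i + ∑ j ∈ G.neighborFinset i, a' i j)
        - (1 / (Fintype.card ι : ℝ)) • r := by
    rw [← hares i, map_sub]
    abel
  rw [e3, inner_sub_right, real_inner_smul_right, sub_nonpos, one_div_mul_eq_div,
    le_div_iff₀ hcard, mul_comm, ← real_inner_smul_right]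
  refine hnormal _ ?_
  rw [norm_smul, Real.norm_of_nonneg hcard.le, mul_comm, ← le_div_iff₀ hcard]
  exact hx'' i

/-- A fixed point of the Douglas–Rachford operator yields a solution of the global problem. -/
theorem solution_of_douglasRachford_fixedPoint [DecidableEq ι]
    (hG : G.Connected) (hnbr : ∀ i, ∃ j, G.Adj i j) (hc : 0 < c)
    (hPD : ∀ ζ, P ζ ∈ D) (hP : ∀ ζ, ∀ w ∈ D, inner ℝ (ζ - P ζ) (w - P ζ) ≤ c * (φ w - φ (P ζ)))
    (hJ : ∀ x, J x ∈ agentSet G L y (ε / Fintype.card ι))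
    (hJ' : ∀ x, ∀ w ∈ agentSet G L y (ε / Fintype.card ι), inner ℝ (x - J x) (w - J x) ≤ 0)
    {z : ArcSpace G U V} (hz : J ((2 : ℝ) • edgeMap G U P z - z) = edgeMap G U P z) :
    ∃ β : V, (∀ d, (edgeMap G U P z d).snd = β) ∧ β ∈ D ∧ ‖(∑ i, L i) β - ∑ i, y i‖ ≤ ε ∧
      ∀ β' ∈ D, ‖(∑ i, L i) β' - ∑ i, y i‖ ≤ ε → φ β ≤ φ β' := by
  have hmem := hJ ((2 : ℝ) • edgeMap G U P z - z)
  rw [hz] at hmem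
  obtain ⟨p, β, hx⟩ := exists_eq_arcMk_of_mem_agentSet hnbr hmem
  obtain ⟨a, b, rfl⟩ := exists_eq_arcMk z
  have hp : ∀ i j, G.Adj i j → p i j = (1 / 2 : ℝ) • (a i j - a j i) := fun i j h =>
    (congrArg (fun x : ArcSpace G U V => (x ⟨i, j, h⟩).fst) hx).symm
  have hb : ∀ i j, G.Adj i j → β i = P ((1 / 2 : ℝ) • (b i j + b j i)) := fun i j h =>
    (congrArg (fun x : ArcSpace G U V => (x ⟨i, j, h⟩).snd) hx).symm
  have hconst := eq_of_forall_adj_eq hG (β := β) fun i j h => by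
    rw [hb i j h, hb j i h.symm, add_comm]
  obtain ⟨o⟩ := hG.nonempty
  obtain ⟨o', ho'⟩ := hnbr o
  have hβ : β = fun _ => β o := funext fun i => hconst i o
  generalize β o = β₀ at hβ
  subst hβ
  refine ⟨β₀, fun d => by rw [hx]; rfl, ?_, ?_, fun β' hβ' hfeas' => ?_⟩
  · have := hb o o' ho'
    simp only at this
    rw [this]
    exact hPD _
  · rw [hx] at hmem
    refine norm_residual_le_of_antisymm hG (a := p) (fun i j h => ?_)
      ((arcMk_mem_agentSet hnbr (β := fun _ => β₀)).1 hmem)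
    rw [hp i j h, hp j i h.symm]
    module
  · obtain ⟨a', ha', hmem'⟩ := exists_flow_mem_agentSet hG hnbr hfeas'
    have h1 := hJ' ((2 : ℝ) • edgeMap G U P (arcMk G a b) - arcMk G a b) _ hmem'
    rw [hz, hx, smul_arcMk, arcMk_sub, arcMk_sub, arcMk_sub, inner_arcMk] at h1
    simp only [Pi.sub_apply, Pi.smul_apply] at h1
    -- Over opposite arcs the `a` terms cancel, since `a' - p` is antisymmetric and `p - a`
    -- symmetric; the `b` terms are bounded by the proximal inequality.
    have h2 : ∑ i, ∑ j ∈ G.neighborFinset i, -(c * (φ β' - φ β₀))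
        ≤ ∑ i, ∑ j ∈ G.neighborFinset i, (inner ℝ ((2 : ℝ) • p i j - a i j - p i j) (a' i j - p i j)
          + inner ℝ ((2 : ℝ) • β₀ - b i j - β₀) (β' - β₀)) := by
      refine sum_neighborFinset_le_of_symm fun i j hij => ?_
      have h3 := hP ((1 / 2 : ℝ) • (b i j + b j i)) β' hβ'
      have h4 : β₀ = P ((1 / 2 : ℝ) • (b i j + b j i)) := hb i j hij
      rw [← h4] at h3
      have e1 : a' j i - p j i = -(a' i j - p i j) := by
        rw [ha' i j, hp i j hij, hp j i hij.symm]
        module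
      have e2 : (2 : ℝ) • p i j - a i j - p i j = (2 : ℝ) • p j i - a j i - p j i := by
        rw [hp i j hij, hp j i hij.symm]
        module
      have e3 : inner ℝ ((2 : ℝ) • β₀ - b i j - β₀) (β' - β₀)
          + inner ℝ ((2 : ℝ) • β₀ - b j i - β₀) (β' - β₀)
          = -(2 * inner ℝ ((1 / 2 : ℝ) • (b i j + b j i) - β₀) (β' - β₀)) := by
        rw [← inner_add_left, ← real_inner_smul_left, ← inner_neg_left]
        congr 1
        module
      rw [e1, e2, inner_neg_right]
      linarith
    have h5 := h2.trans h1
    by_contra! hlt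
    have hneg : 0 < -(c * (φ β' - φ β₀)) := by nlinarith
    refine absurd h5 (not_le.2 ?_)
    refine Finset.sum_pos (fun i _ => Finset.sum_pos (fun _ _ => hneg) ?_) ⟨o, Finset.mem_univ o⟩
    obtain ⟨j, hj⟩ := hnbr i
    exact ⟨j, by simpa using hj⟩

end Consensus

/-! ### Runs of the scheme as Douglas–Rachford iterations -/

section Runs

set_option linter.unusedSectionVars false

variable {m n p : ℕ} {G : SimpleGraph (Fin m)} [DecidableRel G.Adj]
  {f : EuclideanSpace ℝ (Fin p) → EReal} {ε lam ρ : ℝ}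
  {Xs : Fin m → Matrix (Fin n) (Fin p) ℝ} {ys : Fin m → EuclideanSpace ℝ (Fin n)}

/-- The proximal operator of `(λ/2) f`. -/
abbrev halfProx (lam : ℝ) (f : EuclideanSpace ℝ (Fin p) → EReal) :
    EuclideanSpace ℝ (Fin p) → EuclideanSpace ℝ (Fin p) :=
  prox fun x => ((lam / 2 : ℝ) : EReal) * f x

/-- The local costs sum up to a squared distance in `ArcSpace`. -/
theorem sum_localCost (a α : Fin m → Fin m → EuclideanSpace ℝ (Fin n))
    (b : Fin m → Fin m → EuclideanSpace ℝ (Fin p)) (β : Fin m → EuclideanSpace ℝ (Fin p)) :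
    ‖(2 : ℝ) • edgeMap G (EuclideanSpace ℝ (Fin n)) (halfProx lam f) (arcMk G a b) - arcMk G a b
        - arcMk G α (fun i _ => β i)‖ ^ 2
      = ∑ i, localCost lam f (G.neighborFinset i) (fun j => a j i) (b i) (fun j => b j i)
          (α i) (β i) := by
  rw [edgeMap_arcMk, smul_arcMk, arcMk_sub, arcMk_sub, norm_sq_arcMk]
  refine Finset.sum_congr rfl fun i _ => Finset.sum_congr rfl fun j _ => ?_
  simp only [Pi.sub_apply, Pi.smul_apply, F]
  congr 2
  · rw [← norm_neg]
    congr 1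
    module
  · rw [← norm_neg]
    congr 1
    abel

theorem exists_adj_of_connected (hm : 2 ≤ m) (hG : G.Connected) (i : Fin m) :
    ∃ j, G.Adj i j := by
  have : Nontrivial (Fin m) := Fin.nontrivial_iff_two_le.2 hm
  obtain ⟨j, hj⟩ := exists_ne i
  obtain ⟨w⟩ := hG.preconnected i j
  cases w with
  | nil => exact absurd rfl hj
  | cons h _ => exact ⟨_, h⟩

variable {J : ArcSpace G (EuclideanSpace ℝ (Fin n)) (EuclideanSpace ℝ (Fin p)) →
    ArcSpace G (EuclideanSpace ℝ (Fin n)) (EuclideanSpace ℝ (Fin p))}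

/-- A run is a relaxed Douglas–Rachford iteration. -/
theorem IsRun.douglasRachford (hnbr : ∀ i, ∃ j, G.Adj i j)
    (hJ : ∀ x, J x ∈ agentSet G (fun i => Matrix.toEuclideanLin (Xs i)) ys (ε / m))
    (hJ' : ∀ x, ∀ w ∈ agentSet G (fun i => Matrix.toEuclideanLin (Xs i)) ys (ε / m),
      inner ℝ (x - J x) (w - J x) ≤ 0)
    {R : Iterates m n p} (hR : IsRun G f ε Xs ys lam ρ R) (k : ℕ) :
    J ((2 : ℝ) • edgeMap G _ (halfProx lam f) (arcMk G (R.a k) (R.b k))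
        - arcMk G (R.a k) (R.b k))
      = arcMk G (R.aHat (k + 1)) (fun i _ => R.betaHat (k + 1) i) ∧
    arcMk G (R.a (k + 1)) (R.b (k + 1)) = arcMk G (R.a k) (R.b k)
      + ρ • (J ((2 : ℝ) • edgeMap G _ (halfProx lam f) (arcMk G (R.a k) (R.b k))
          - arcMk G (R.a k) (R.b k))
        - edgeMap G _ (halfProx lam f) (arcMk G (R.a k) (R.b k))) := by
  have h1 : J ((2 : ℝ) • edgeMap G _ (halfProx lam f) (arcMk G (R.a k) (R.b k))
        - arcMk G (R.a k) (R.b k))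
      = arcMk G (R.aHat (k + 1)) (fun i _ => R.betaHat (k + 1) i) := by
    refine projection_eq_of_inner_le hJ hJ'
      ((arcMk_mem_agentSet hnbr).2 fun i => hR.feasible k i) fun w hw => ?_
    obtain ⟨α, β, rfl⟩ := exists_eq_arcMk_of_mem_agentSet hnbr hw
    have hw' := (arcMk_mem_agentSet hnbr).1 hw
    rw [sum_localCost, sum_localCost]
    exact Finset.sum_le_sum fun i _ => hR.minimal k i _ _ (hw' i)
  refine ⟨h1, ?_⟩
  rw [h1, edgeMap_arcMk, arcMk_sub, smul_arcMk, arcMk_add]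
  refine arcMk_congr (fun i j hij => ?_) fun i j hij => ?_
  · rw [hR.update_a k i j hij]
    simp only [Pi.add_apply, Pi.smul_apply, Pi.sub_apply]
    module
  · rw [hR.update_b k i j hij]
    simp only [Pi.add_apply, Pi.smul_apply, Pi.sub_apply, F]
    module

/-- The scheme can be run from every initialization. -/
theorem exists_isRun (hnbr : ∀ i, ∃ j, G.Adj i j)
    (hJ : ∀ x, J x ∈ agentSet G (fun i => Matrix.toEuclideanLin (Xs i)) ys (ε / m))
    (hJ' : ∀ x, ∀ w ∈ agentSet G (fun i => Matrix.toEuclideanLin (Xs i)) ys (ε / m),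
      inner ℝ (x - J x) (w - J x) ≤ 0)
    (a₀ : Fin m → Fin m → EuclideanSpace ℝ (Fin n))
    (b₀ : Fin m → Fin m → EuclideanSpace ℝ (Fin p)) :
    ∃ R : Iterates m n p, IsRun G f ε Xs ys lam ρ R ∧ R.a 0 = a₀ ∧ R.b 0 = b₀ := by
  choose α β hαβ using fun a b => exists_eq_arcMk_of_mem_agentSet hnbr
    (hJ ((2 : ℝ) • edgeMap G _ (halfProx lam f) (arcMk G a b) - arcMk G a b))
  let S : Type := (Fin m → Fin m → EuclideanSpace ℝ (Fin n)) ×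
    (Fin m → Fin m → EuclideanSpace ℝ (Fin p))
  let step : S → S := fun s =>
    (fun i j => s.1 i j - (ρ / 2) • (s.1 i j - s.1 j i) + ρ • α s.1 s.2 i j,
      fun i j => s.2 i j - (ρ / 2) • F lam f (s.2 i j + s.2 j i) + ρ • β s.1 s.2 i)
  let s : ℕ → S := fun k => step^[k] (a₀, b₀)
  have hs : ∀ k, s (k + 1) = step (s k) := fun k => Function.iterate_succ_apply' step k _
  -- The hatted vectors with index `k + 1` come from state `k`; their entries at index `0` are junk.
  refine ⟨⟨fun k => (s k).1, fun k => (s k).2, fun k => α (s (k - 1)).1 (s (k - 1)).2,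
    fun k => β (s (k - 1)).1 (s (k - 1)).2⟩, ⟨fun k i => ?_, fun k i a' β' hfeas => ?_,
    fun k i j _ => ?_, fun k i j _ => ?_⟩, rfl, rfl⟩
  · have := hJ ((2 : ℝ) • edgeMap G _ (halfProx lam f) (arcMk G (s k).1 (s k).2)
      - arcMk G (s k).1 (s k).2)
    rw [hαβ] at this
    exact (arcMk_mem_agentSet hnbr).1 this i
  · simp only [Nat.add_sub_cancel]
    set a := (s k).1
    set b := (s k).2
    have hmem := hJ ((2 : ℝ) • edgeMap G _ (halfProx lam f) (arcMk G a b) - arcMk G a b)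
    rw [hαβ] at hmem
    have hmem' := (arcMk_mem_agentSet hnbr).1 hmem
    -- Only agent `i` deviates. The other local costs are unchanged, so a local improvement would
    -- beat the projection.
    have hw : arcMk G (Function.update (α a b) i a') (fun i' _ => Function.update (β a b) i β' i')
        ∈ agentSet G (fun i => Matrix.toEuclideanLin (Xs i)) ys (ε / m) := by
      refine (arcMk_mem_agentSet hnbr).2 fun i' => ?_
      by_cases h : i' = i
      · subst h
        simpa [LocalFeasible] using hfeas
      · simpa [Function.update_of_ne h] using hmem' i'
    have h1 := norm_sub_sq_add_le_of_projection hJ'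
      ((2 : ℝ) • edgeMap G _ (halfProx lam f) (arcMk G a b) - arcMk G a b) hw
    have h2 := (le_add_of_nonneg_right (sq_nonneg _)).trans h1
    rw [hαβ a b, sum_localCost, sum_localCost] at h2
    by_contra! hlt
    refine absurd h2 (not_le.2 (Finset.sum_lt_sum (fun i' _ => ?_) ⟨i, Finset.mem_univ i, ?_⟩))
    · by_cases h : i' = i
      · subst h
        simpa using hlt.le
      · simp [Function.update_of_ne h]
    · simpa using hlt
  · simp only [hs, step, Nat.add_sub_cancel]
  · simp only [hs, step, Nat.add_sub_cancel]

end Runs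

end InNetworkDR

end

/-! ### The convergence theorem -/

theorem proposition2 {m n p : ℕ} (hm : 2 ≤ m)
    (G : SimpleGraph (Fin m)) [DecidableRel G.Adj] (hG : G.Connected)
    (f : EuclideanSpace ℝ (Fin p) → EReal) (hf : InNetworkDR.IsClosedProperConvex f) (ε : ℝ)
    (X : Matrix (Fin n) (Fin p) ℝ) (y : EuclideanSpace ℝ (Fin n))
    (Xs : Fin m → Matrix (Fin n) (Fin p) ℝ) (ys : Fin m → EuclideanSpace ℝ (Fin n))
    (hX : X = ∑ i, Xs i) (hy : y = ∑ i, ys i)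
    (hsol : ∃ β, InNetworkDR.SolvesP1 f ε Xs ys β)
    (hqual : ∃ β ∈ intrinsicInterior ℝ (InNetworkDR.effDom f),
      InNetworkDR.residual (∑ i, Xs i) (∑ i, ys i) β < ε ∨
        (ε = 0 ∧ InNetworkDR.residual (∑ i, Xs i) (∑ i, ys i) β = 0))
    (lam ρ : ℝ) (hlam : 0 < lam) (hρ : 0 < ρ) (hρ2 : ρ < 2) :
    (∀ (a₀ : Fin m → Fin m → EuclideanSpace ℝ (Fin n))
        (b₀ : Fin m → Fin m → EuclideanSpace ℝ (Fin p)),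
      ∃ R : InNetworkDR.Iterates m n p,
        InNetworkDR.IsRun G f ε Xs ys lam ρ R ∧ R.a 0 = a₀ ∧ R.b 0 = b₀) ∧
    (∀ R : InNetworkDR.Iterates m n p, InNetworkDR.IsRun G f ε Xs ys lam ρ R →
      ∃ βstar : EuclideanSpace ℝ (Fin p),
        InNetworkDR.SolvesP1 f ε Xs ys βstar ∧ InNetworkDR.SolvesP0 f ε X y βstar ∧
          ∀ i : Fin m, Tendsto (fun k => R.betaHat k i) atTop (𝓝 βstar)) := by
  open InNetworkDR in
  subst hX hy
  have hnbr := exists_adj_of_connected hm hG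
  have hc : 0 < lam / 2 := half_pos hlam
  obtain ⟨βs, hβs⟩ := hsol
  set L : Fin m → EuclideanSpace ℝ (Fin p) →ₗ[ℝ] EuclideanSpace ℝ (Fin n) :=
    fun i => Matrix.toEuclideanLin (Xs i) with hL
  have hLsum : ∑ i, L i = Matrix.toEuclideanLin (∑ i, Xs i) := (map_sum _ _ _).symm
  have hres : ∀ β, InNetworkDR.residual (∑ i, Xs i) (∑ i, ys i) β = ‖(∑ i, L i) β - ∑ i, ys i‖ := by
    intro β
    rw [InNetworkDR.residual, hLsum]
  have hfeas := hβs.feasible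
  simp only [hres] at hqual hfeas
  have hmin : ∀ β ∈ effDom f, ‖(∑ i, L i) β - ∑ i, ys i‖ ≤ ε → (f βs).toReal ≤ (f β).toReal := by
    intro β hβ h
    have := hβs.minimal β (by rwa [hres])
    rwa [← hf.coe_toReal hβs.finite, ← hf.coe_toReal hβ, EReal.coe_le_coe_iff] at this
  obtain ⟨ν, hν⟩ := exists_lagrange_multiplier (∑ i, L i) (∑ i, ys i) hf.convexOn hβs.finite
    hfeas hmin hqual
  obtain ⟨a₁, -, ha₁⟩ := exists_flow_mem_agentSet hG hnbr hfeas
  rw [Fintype.card_fin] at ha₁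
  obtain ⟨J, hJ, hJ'⟩ := exists_convex_projection ⟨_, ha₁⟩ isClosed_agentSet convex_agentSet
  refine ⟨fun a₀ b₀ => exists_isRun hnbr hJ hJ' a₀ b₀, fun R hR => ?_⟩
  have hprox := fun ζ => (isProx_mul_iff_inner hf hc).1 (isProx_prox_mul hf hc ζ)
  have hPfirm : FirmlyNonexpansive (halfProx lam f) := norm_sub_sq_prox_mul_le_inner hf hc
  have hfix : ∃ z, J ((2 : ℝ) • edgeMap G _ (halfProx lam f) z - z)
      = edgeMap G _ (halfProx lam f) z := by
    refine exists_douglasRachford_fixedPoint (L := L) (y := ys) (ε := ε) hG hnbr hc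
      (fun ζ z hz h => IsProx.prox_mul_eq hf hc ((isProx_mul_iff_inner hf hc).2 ⟨hz, h⟩))
      (fun x q hq h => ?_) hβs.finite hfeas hν
    rw [Fintype.card_fin] at hq h
    have h1 := h _ (hJ x)
    have h2 := hJ' x q hq
    -- Adding the two variational inequalities gives `‖J x - q‖² ≤ 0`.
    have e : inner ℝ (x - q) (J x - q) + inner ℝ (x - J x) (q - J x) = ‖J x - q‖ ^ 2 := by
      rw [← neg_sub (J x) q, inner_neg_right, ← sub_eq_add_neg, ← inner_sub_left,
        sub_sub_sub_cancel_left, real_inner_self_eq_norm_sq]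
    have h3 : ‖J x - q‖ = 0 := by nlinarith [norm_nonneg (J x - q)]
    exact sub_eq_zero.1 (norm_eq_zero.1 h3)
  obtain ⟨z, hz, hlim⟩ := douglasRachford_tendsto (firmlyNonexpansive_of_projection hJ hJ')
    (firmlyNonexpansive_edgeMap hPfirm) hρ hρ2 hfix (fun k => arcMk G (R.a k) (R.b k))
    fun k => (hR.douglasRachford hnbr hJ hJ' k).2
  simp only [(hR.douglasRachford hnbr hJ hJ' _).1] at hlim
  obtain ⟨β, hβ, hβD, hβfeas, hβmin⟩ := solution_of_douglasRachford_fixedPoint (L := L) (y := ys)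
    (ε := ε) (D := effDom f) (φ := fun x => (f x).toReal) hG hnbr hc (fun ζ => (hprox ζ).1)
    (fun ζ => (hprox ζ).2) (by rwa [Fintype.card_fin]) (by rwa [Fintype.card_fin]) hz
  have hsolves : SolvesP0 f ε (∑ i, Xs i) (∑ i, ys i) β := by
    refine ⟨by rwa [hres], hβD, fun β' h => ?_⟩
    by_cases hβ' : β' ∈ effDom f
    · rw [← hf.coe_toReal hβD, ← hf.coe_toReal hβ', EReal.coe_le_coe_iff]
      exact hβmin β' hβ' (by rwa [← hres])
    · rw [not_not.1 hβ']
      exact le_top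
  refine ⟨β, hsolves, hsolves, fun i => ?_⟩
  obtain ⟨j, hj⟩ := hnbr i
  rw [← tendsto_add_atTop_iff_nat 1]
  have hcont : Continuous fun x : ArcSpace G (EuclideanSpace ℝ (Fin n))
      (EuclideanSpace ℝ (Fin p)) => (x ⟨i, j, hj⟩).snd := by fun_prop
  have := (hcont.tendsto _).comp hlim
  rw [hβ] at this
  exact this
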